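/- Graphs are finite and undirected and may have parallel edges and self-loops; a self-loop contributes $1$ to the degree of its vertex. For a vertex $v$ of $G=(V,E)$ let $\Gamma(v)$ be the set of vertices joined to $v$ by an edge. A $d$-regular graph $G$ on $m$ vertices is an $(m,d,\gamma)$-spectral expander if the eigenvalue $d$ of its adjacency matrix has multiplicity $1$ and every other eigenvalue has absolute value at most $\gamma d$. A colouring $c:V\to\{0,1\}$ is balanced if $|V|/3\le |c^{-1}(1)|\le 2|V|/3$. If $|\Gamma(u)\cap\Gamma(v)|\le 1$ for all $u\ne v$, then the partial function $g(G,c):V\times V\to\{0,1\}$ is defined by $g(G,c)(u,v)=c(w)$ if $u\neq v$ and $\Gamma(u)\cap\Gamma(v)=\{w\}$, and is undefined otherwise. A rectangle $R=U\times W\subseteq V\times V$ is $b$-monochromatic for $g(G,c)$ if $g(G,c)$ is defined and equal to $b$ on all of $R$. A probability distribution $\mu$ over rectangles is $(\delta,h)$-hitting, for an integer $h$, if for all $X,Y\subseteq V$ with $|X|,|Y|\ge 2^{-h}|V|$ we have $\Pr_{R\sim\mu}[R\cap (X\times Y)\ne\varnothing]\ge 1-\delta$. **Theorem.** Let $\gamma>0$,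 let $G=(V,E)$ be an $(m,d,\gamma)$-spectral expander with $m\ge 1/\gamma^2$ in which $|\Gamma(u)\cap\Gamma(v)|\le 1$ for any two distinct vertices $u,v$, and let $c:V\to\{0,1\}$ be a balanced colouring. Then for each $b\in\{0,1\}$ there is a $\left(\frac1{10},\lfloor 2\log_2(1/\gamma)\rfloor-100\right)$-hitting distribution $\mu_b$ over $b$-monochromatic rectangles of $g(G,c)$, all of whose probabilities are rational. Moreover, these distributions can be chosen so that for each $b$ a single deterministic Turing machine, working for all such $m,d,\gamma,G,c$, does the following in time $m^{O(1)}$, with an absolute implied constant: given $m$, the $0/1$ adjacency matrix of $G$ (which pairs of the vertices $V=\{0,\dots,m-1\}$ are joined by an edge) and the truth table of $c$, it lists all the rectangles in the support of $\mu_b$, each exactly once as a pair $(U,W)$ with $R=U\times W$, together with their $\mu_b$-probabilities, each written as a fraction of two natural numbers in binary. -/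

import Mathlib

/-- A finite undirected graph that may have parallel edges and self-loops, given by its
adjacency matrix: `mult u v` is the number of edges between `u` and `v`, and `mult v v` is the
number of self-loops at `v` (each of them contributes 1 to the degree of `v`). -/
structure Multigraph (V : Type*) where
  mult : V → V → ℕ
  symm : ∀ u v, mult u v = mult v u

namespace Multigraph

variable {V : Type*} [Fintype V]

/-- The neighbourhood `Γ(v)`: all `u` joined to `v` by at least one edge. -/
def nbr (G : Multigraph V) (v : V) : Finset V :=
  Finset.univ.filter fun u => 0 < G.mult v u

/-- Every vertex has degree `d`. -/
def IsRegular (G : Multigraph V) (d : ℕ) : Prop :=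
  ∀ v, ∑ u, G.mult v u = d

/-- The adjacency matrix, with real entries. -/
def adjMat (G : Multigraph V) : Matrix V V ℝ :=
  Matrix.of fun u v => (G.mult u v : ℝ)

/-- `G` is an `(m, d, γ)`-spectral expander: it is a `d`-regular graph on `m` vertices, the
eigenvalue `d` of its adjacency matrix has multiplicity 1, and every other eigenvalue has absolute
value at most `γ d`. (The matrix is symmetric, so its eigenvalues are real, and the multiplicity
of an eigenvalue is the dimension of its eigenspace.) -/
structure IsSpectralExpander [DecidableEq V] (G : Multigraph V) (m d : ℕ) (γ : ℝ) : Prop where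
  card_eq : Fintype.card V = m
  regular : G.IsRegular d
  mult_one :
    Module.finrank ℝ (Module.End.eigenspace (Matrix.toLin' G.adjMat) (d : ℝ)) = 1
  other_le : ∀ ev : ℝ, Module.End.HasEigenvalue (Matrix.toLin' G.adjMat) ev →
    ev ≠ (d : ℝ) → |ev| ≤ γ * d

/-- Any two distinct vertices have at most one common neighbour. -/
def AtMostOneCommonNbr [DecidableEq V] (G : Multigraph V) : Prop :=
  ∀ u v : V, u ≠ v → (G.nbr u ∩ G.nbr v).card ≤ 1

/-- The partial Boolean function `g(G, c) : V × V → {0, 1}`; the value `none` means that it is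
undefined. If any two distinct vertices have at most one common neighbour, then the first two
conditions exclude each other. -/
def gadget [DecidableEq V] (G : Multigraph V) (c : V → Bool) (u v : V) : Option Bool :=
  if u ≠ v ∧ ∃ w ∈ G.nbr u ∩ G.nbr v, c w = true then some true
  else if u ≠ v ∧ ∃ w ∈ G.nbr u ∩ G.nbr v, c w = false then some false
  else none

end Multigraph

/-- A 2-colouring `c` of `V` is balanced if `|V|/3 ≤ |c⁻¹(1)| ≤ 2|V|/3`. -/
def IsBalanced {V : Type*} [Fintype V] (c : V → Bool) : Prop :=
  (Fintype.card V : ℝ) / 3 ≤ ((Finset.univ.filter fun v => c v = true).card : ℝ) ∧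
    ((Finset.univ.filter fun v => c v = true).card : ℝ) ≤ 2 * (Fintype.card V : ℝ) / 3

/-- A set `R ⊆ A × B` is a rectangle if `R = U × W` for some `U ⊆ A` and `W ⊆ B`. -/
def IsRectangle {A B : Type*} (R : Finset (A × B)) : Prop :=
  ∃ (U : Finset A) (W : Finset B), R = U ×ˢ W

/-- `R` is `b`-monochromatic for the partial function `g`: on all of `R` the function is defined
and has the value `b`. -/
def IsMonochromatic {A B : Type*} (g : A → B → Option Bool) (b : Bool)
    (R : Finset (A × B)) : Prop :=
  ∀ q ∈ R, g q.1 q.2 = some b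

/-- `μ` is a distribution over `b`-monochromatic rectangles of the partial function `g`. -/
def IsOverMonoRectangles {A B : Type*} (g : A → B → Option Bool) (b : Bool)
    (μ : PMF (Finset (A × B))) : Prop :=
  ∀ R ∈ μ.support, IsRectangle R ∧ IsMonochromatic g b R

/-- `μ` is `(δ, h)`-hitting: for all `X ⊆ A` and `Y ⊆ B` with `|X| ≥ 2^(-h) |A|` and
`|Y| ≥ 2^(-h) |B|`, a set drawn from `μ` meets `X × Y` with probability at least `1 - δ`. -/
def IsHitting {A B : Type*} [Fintype A] [Fintype B] (μ : PMF (Finset (A × B)))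
    (δ : ℝ) (h : ℤ) : Prop :=
  ∀ (X : Finset A) (Y : Finset B),
    (2 : ℝ) ^ (-h) * (Fintype.card A : ℝ) ≤ (X.card : ℝ) →
    (2 : ℝ) ^ (-h) * (Fintype.card B : ℝ) ≤ (Y.card : ℝ) →
      1 - δ ≤ (μ.toOuterMeasure {R | ¬ Disjoint R (X ×ˢ Y)}).toReal

/-- An entry of a listing: the two sides of a rectangle, and a fraction. -/
structure ListEntry (m : ℕ) where
  left : Finset (Fin m)
  right : Finset (Fin m)
  num : ℕ
  den : ℕ

/-- The rectangle of an entry, as a set of pairs. -/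
def ListEntry.rect {m : ℕ} (e : ListEntry m) : Finset (Fin m × Fin m) :=
  e.left ×ˢ e.right

/-- `L` lists every rectangle of the support of `μ` exactly once, and nothing else, together with
the probability that `μ` assigns to it, written as a fraction. -/
structure IsListing {m : ℕ} (μ : PMF (Finset (Fin m × Fin m))) (L : List (ListEntry m)) :
    Prop where
  nodup : (L.map ListEntry.rect).Nodup
  mem_iff : ∀ R, R ∈ L.map ListEntry.rect ↔ R ∈ μ.support
  den_pos : ∀ e ∈ L, 0 < e.den
  prob_eq : ∀ e ∈ L, (μ e.rect).toReal = (e.num : ℝ) / (e.den : ℝ)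

/-- The input word of a machine: `m` in unary, the 0/1 adjacency matrix of `G` row by row (which
pairs of vertices are joined by an edge), and the truth table of `c`. Multiplicities of edges are
withheld from the machine, so that the word has length `m^2 + 2 m + 1`. -/
def encodeInput {m : ℕ} (G : Multigraph (Fin m)) (c : Fin m → Bool) : List Bool :=
  List.replicate m true ++ [false] ++
    ((List.finRange m).flatMap fun u => (List.finRange m).map fun v => decide (v ∈ G.nbr u)) ++
    (List.finRange m).map c

/-- The characteristic vector of a set of vertices. -/
def encodeSet {m : ℕ} (U : Finset (Fin m)) : List (Option Bool) :=
  (List.finRange m).map fun v => some (decide (v ∈ U))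

/-- A natural number in binary, the least significant bit first. -/
def encodeNumber (n : ℕ) : List (Option Bool) :=
  n.bits.map some

/-- An entry is written as its four fields, each followed by the separator `none`. -/
def encodeEntry {m : ℕ} (e : ListEntry m) : List (Option Bool) :=
  encodeSet e.left ++ [none] ++ encodeSet e.right ++ [none] ++
    encodeNumber e.num ++ [none] ++ encodeNumber e.den ++ [none]

/-- The output word of a machine: the entries of the list one after the other. -/
def encodeListing {m : ℕ} (L : List (ListEntry m)) : List (Option Bool) :=
  L.flatMap encodeEntry

/-- The deterministic Turing machine `M`, started on the word `x`, halts after at most `t` steps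
with the word `y` as its output. -/
def OutputsWithin (M : Turing.TM2ComputableAux Bool (Option Bool)) (x : List Bool)
    (y : List (Option Bool)) (t : ℕ) : Prop :=
  Nonempty (Turing.TM2OutputsInTime M.tm (x.map M.inputAlphabet.symm)
    (some (y.map M.outputAlphabet.symm)) t)

/-! If `U` and `W` are disjoint sets of neighbours of `w`, then any `u ∈ U` and `v ∈ W` are distinct
vertices whose only common neighbour is `w`, so `U × W` is monochromatic with the colour of `w`. For
hitting, a random split of the neighbourhood of a random vertex `w` of colour `b` would do, but it
has exponentially many outcomes. A small family of splits with a good second moment suffices.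

Order the neighbours of `w` increasingly. Position 0 always goes left and position 1 always goes
right; the others get ranks `x < D`, where `D` is the number of neighbours minus 2. For each `a < D`
the neighbour of rank `a` is dropped, and any other rank `x` goes left or right according to the
inner product modulo 2 of the binary digits of `a` and `x`. The two fixed vertices determine `w`,
since they have one common neighbour, and the dropped vertex determines `a`. So all these rectangles
are nonempty and pairwise different (`rect_entry_inj`), and no duplicates have to be merged in the
listing. With `N` vertices of colour `b`, each rectangle gets probability `1 / (D (1 + N))`: a
vertex is drawn uniformly from the colour class and one phantom element, then `a` uniformly. The
phantom and the vertices with `D = 0` give the empty rectangle, whose probability is therefore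
always positive.

Hitting rests on two facts. By Cauchy–Schwarz and the spectral bound on vectors orthogonal to the
constants, sets `S` and `X` without edges between them satisfy `|S| |X| ≤ γ² m²`
(`card_mul_card_le`). Cutting a set of size at least `2^100 γ² m` into 100 blocks, all but `m /
10^6` vertices have at least 100 neighbours in it (`card_few_nbr_le`). For such a vertex, take 98
ranks `A` of neighbours in `X`. Orthogonality of characters bounds the sum over `a` of `(∑ x ∈ A,
±1)²` by `2 D |A|`, whereas each `a` for which no vertex of `A` goes left contributes at least `96²`
(`card_constant_le`). The same holds for `Y` and the right side, so at least 19/20 of the splits of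
the vertex hit `X × Y`. As the colour class has at least `m / 3` vertices, the total is at least
9/10.

The time bound comes from an explicit program in a small language of stack commands, compiled to a
`TM2` machine (`Exec.leads`). Its output is a stack, so the listing is produced from its last symbol
to its first. Only neighbourhoods enter the construction; edge multiplicities and `d` serve the
analysis alone. -/

/-! ### A structured language for stack machines -/

/-- Commands over work stacks indexed by `W` with the alphabet `Bool`, a write-only output stack,
and a finite control state `σ`. -/
inductive Cmd (W σ : Type)
  | push (w : W) (f : σ → Bool)
  | emit (f : σ → Option Bool)
  | pop (w : W) (f : σ → Option Bool → σ)
  | load (f : σ → σ)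
  | seq (a b : Cmd W σ)
  | ite (p : σ → Bool) (a b : Cmd W σ)
  | loop (w : W) (f : σ → Option Bool → σ) (p : σ → Bool) (body : Cmd W σ)

/-- The control state, the work stacks and the output stack. -/
structure Mem (W σ : Type) where
  var : σ
  stk : W → List Bool
  out : List (Option Bool)

namespace Cmd

variable {W σ : Type}

section Exec

variable [DecidableEq W]

/-- `Exec c s s' t`: the command `c`, started in `s`, ends in `s'` within `t` steps. -/
inductive Exec : Cmd W σ → Mem W σ → Mem W σ → ℕ → Prop
  | push (w f v S o) : Exec (push w f) ⟨v, S, o⟩ ⟨v, Function.update S w (f v :: S w), o⟩ 1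
  | emit (f v S o) : Exec (emit f) ⟨v, S, o⟩ ⟨v, S, f v :: o⟩ 1
  | pop (w f v S o) :
      Exec (pop w f) ⟨v, S, o⟩ ⟨f v (S w).head?, Function.update S w (S w).tail, o⟩ 1
  | load (f v S o) : Exec (load f) ⟨v, S, o⟩ ⟨f v, S, o⟩ 1
  | seq {a b s s' s'' t t'} : Exec a s s' t → Exec b s' s'' t' → Exec (seq a b) s s'' (t + t')
  | ite_true {p a b s s' t} : p s.var = true → Exec a s s' t → Exec (ite p a b) s s' (1 + t)
  | ite_false {p a b s s' t} : p s.var = false → Exec b s s' t → Exec (ite p a b) s s' (1 + t)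
  | loop_exit {w f p body v S o} : p (f v (S w).head?) = false →
      Exec (loop w f p body) ⟨v, S, o⟩
        ⟨f v (S w).head?, Function.update S w (S w).tail, o⟩ 1
  | loop_step {w f p body v S o s' s'' t t'} : p (f v (S w).head?) = true →
      Exec body ⟨f v (S w).head?, Function.update S w (S w).tail, o⟩ s' t →
      Exec (loop w f p body) s' s'' t' → Exec (loop w f p body) ⟨v, S, o⟩ s'' (1 + t + t')
  | mono {c s s' t t'} : Exec c s s' t → t ≤ t' → Exec c s s' t'

end Exec

/-- The control points of a command. -/
def Lab : Cmd W σ → Type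
  | push _ _ | emit _ | pop _ _ | load _ => Unit
  | seq a b => Lab a ⊕ Lab b
  | ite _ a b => Option (Lab a ⊕ Lab b)
  | loop _ _ _ c => Option (Lab c)

instance Lab.fintype : (c : Cmd W σ) → Fintype (Lab c)
  | push _ _ | emit _ | pop _ _ | load _ => inferInstanceAs (Fintype Unit)
  | seq a b =>
    letI := Lab.fintype a; letI := Lab.fintype b; inferInstanceAs (Fintype (Lab a ⊕ Lab b))
  | ite _ a b =>
    letI := Lab.fintype a; letI := Lab.fintype b
    inferInstanceAs (Fintype (Option (Lab a ⊕ Lab b)))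
  | loop _ _ _ c => letI := Lab.fintype c; inferInstanceAs (Fintype (Option (Lab c)))

/-- The first control point of a command. -/
def start : (c : Cmd W σ) → Lab c
  | push _ _ | emit _ | pop _ _ | load _ => ()
  | seq a _ => Sum.inl (start a)
  | ite _ _ _ => none
  | loop _ _ _ _ => none

/-- The alphabets of the stacks: `none` is the output stack. -/
def Alph (W : Type) : Option W → Type
  | none => Option Bool
  | some _ => Bool

/-- The statement at each control point; control leaves the command through `exit`. -/
def compile {Λ : Type} : (c : Cmd W σ) → (Lab c → Λ) → Λ → Lab c → Turing.TM2.Stmt (Alph W) Λ σ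
  | push w f, _, exit, _ => .push (some w) f (.goto fun _ => exit)
  | emit f, _, exit, _ => .push none f (.goto fun _ => exit)
  | pop w f, _, exit, _ => .pop (some w) f (.goto fun _ => exit)
  | load f, _, exit, _ => .load f (.goto fun _ => exit)
  | seq a b, emb, exit, l =>
    match l with
    | Sum.inl l => compile a (emb ∘ Sum.inl) (emb (Sum.inr (start b))) l
    | Sum.inr l => compile b (emb ∘ Sum.inr) exit l
  | ite p a b, emb, exit, l =>
    match l with
    | none => .branch p (.goto fun _ => emb (some (Sum.inl (start a))))
        (.goto fun _ => emb (some (Sum.inr (start b))))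
    | some (Sum.inl l) => compile a (emb ∘ some ∘ Sum.inl) exit l
    | some (Sum.inr l) => compile b (emb ∘ some ∘ Sum.inr) exit l
  | loop w f p c, emb, exit, l =>
    match l with
    | none => .pop (some w) f
        (.branch p (.goto fun _ => emb (some (start c))) (.goto fun _ => exit))
    | some l => compile c (emb ∘ some) (emb none) l

/-- All stacks of a memory together. -/
def allStk (S : W → List Bool) (o : List (Option Bool)) : (k : Option W) → List (Alph W k)
  | none => o
  | some w => S w

variable [DecidableEq W]

theorem update_allStk_some (S : W → List Bool) (o : List (Option Bool)) (w : W)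
    (l : List (Alph W (some w))) :
    Function.update (allStk S o) (some w) l = allStk (Function.update S w l) o := by
  funext k
  cases k with
  | none => exact Function.update_of_ne (by simp) _ _
  | some k =>
    by_cases h : k = w
    · subst h
      exact (Function.update_self _ _ _).trans (Function.update_self (f := S) _ _).symm
    · exact (Function.update_of_ne (by simpa using h) _ _).trans
        (Function.update_of_ne (f := S) h _).symm

theorem update_allStk_none (S : W → List Bool) (o : List (Option Bool))
    (o' : List (Alph W none)) :
    Function.update (allStk S o) none o' = allStk S o' := by
  funext k
  cases k with
  | none => exact Function.update_self _ _ _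
  | some k => exact Function.update_of_ne (by simp) _ _

/-- The configuration of the machine at the control point `l` with the memory `s`. -/
def cfg {Λ : Type} (l : Option Λ) (s : Mem W σ) : Turing.TM2.Cfg (Alph W) Λ σ :=
  ⟨l, s.var, allStk s.stk s.out⟩

/-- Configuration `a` leads to `b` in at most `t` steps. -/
def Leads {Λ : Type} (M : Λ → Turing.TM2.Stmt (Alph W) Λ σ)
    (a b : Turing.TM2.Cfg (Alph W) Λ σ) (t : ℕ) : Prop :=
  ∃ n ≤ t, (flip bind (Turing.TM2.step M))^[n] (some a) = some b

theorem Leads.trans {Λ : Type} {M : Λ → Turing.TM2.Stmt (Alph W) Λ σ}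
    {a b c : Turing.TM2.Cfg (Alph W) Λ σ} {t t' : ℕ} (h : Leads M a b t) (h' : Leads M b c t') :
    Leads M a c (t + t') := by
  obtain ⟨n, hn, h⟩ := h
  obtain ⟨n', hn', h'⟩ := h'
  refine ⟨n' + n, by omega, ?_⟩
  rw [Function.iterate_add_apply, h, h']

theorem Leads.single {Λ : Type} {M : Λ → Turing.TM2.Stmt (Alph W) Λ σ}
    {a b : Turing.TM2.Cfg (Alph W) Λ σ} (h : Turing.TM2.step M a = some b) : Leads M a b 1 :=
  ⟨1, le_rfl, by simpa [flip] using h⟩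

theorem cfg_update {Λ : Type} (l : Option Λ) (v : σ) (S : W → List Bool) (o : List (Option Bool))
    (w : W) (r : List Bool) :
    cfg l ⟨v, Function.update S w r, o⟩ =
      (⟨l, v, Function.update (allStk S o) (some w) r⟩ : Turing.TM2.Cfg (Alph W) Λ σ) := by
  exact congrArg (Turing.TM2.Cfg.mk l v) (update_allStk_some S o w r).symm

theorem cfg_emit {Λ : Type} (l : Option Λ) (v : σ) (S : W → List Bool) (o : List (Option Bool))
    (x : Option Bool) :
    cfg l ⟨v, S, x :: o⟩ =
      (⟨l, v, Function.update (allStk S o) none (x :: o)⟩ : Turing.TM2.Cfg (Alph W) Λ σ) := by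
  exact congrArg (Turing.TM2.Cfg.mk l v) (update_allStk_none S o (x :: o)).symm

theorem step_cfg {Λ : Type} (M : Λ → Turing.TM2.Stmt (Alph W) Λ σ) (l : Λ) (s : Mem W σ) :
    Turing.TM2.step M (cfg (some l) s) =
      some (Turing.TM2.stepAux (M l) s.var (allStk s.stk s.out)) := rfl

/-- Induction on the execution. The embedding of control points and the exit are arbitrary because a
subcommand sits inside a larger machine: the first half of a sequence exits to the start of the
second, and a loop body exits to the guard of its loop. -/
theorem Exec.leads {c : Cmd W σ} {s s' : Mem W σ} {t : ℕ} (h : Exec c s s' t) {Λ : Type}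
    (M : Λ → Turing.TM2.Stmt (Alph W) Λ σ) (emb : Lab c → Λ) (exit : Λ)
    (hM : ∀ l, M (emb l) = compile c emb exit l) :
    Leads M (cfg (some (emb (start c))) s) (cfg (some exit) s') t := by
  induction h generalizing exit with
  | push w f v S o =>
    apply Leads.single
    rw [step_cfg, hM, cfg_update]
    rfl
  | emit f v S o =>
    apply Leads.single
    rw [step_cfg, hM, cfg_emit]
    rfl
  | pop w f v S o =>
    apply Leads.single
    rw [step_cfg, hM, cfg_update]
    rfl
  | load f v S o =>
    apply Leads.single
    rw [step_cfg, hM]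
    rfl
  | @seq a b s s' s'' t t' _ _ ih ih' =>
    exact (ih (emb ∘ Sum.inl) (emb (Sum.inr (start b))) fun l => hM (Sum.inl l)).trans
      (ih' (emb ∘ Sum.inr) exit fun l => hM (Sum.inr l))
  | @ite_true p a b s s' t hp _ ih =>
    refine Leads.trans (Leads.single ?_)
      (ih (emb ∘ some ∘ Sum.inl) exit fun l => hM (some (Sum.inl l)))
    rw [step_cfg, hM]
    change some (cond (p s.var) _ _) = _
    rw [hp]
    rfl
  | @ite_false p a b s s' t hp _ ih =>
    refine Leads.trans (Leads.single ?_)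
      (ih (emb ∘ some ∘ Sum.inr) exit fun l => hM (some (Sum.inr l)))
    rw [step_cfg, hM]
    change some (cond (p s.var) _ _) = _
    rw [hp]
    rfl
  | @loop_exit w f p body v S o hp =>
    apply Leads.single
    rw [step_cfg, hM, cfg_update]
    change some (cond (p (f v (S w).head?)) _ _) = _
    rw [hp]
    rfl
  | @loop_step w f p body v S o s' s'' t t' hp _ _ ih ih' =>
    refine Leads.trans (Leads.trans (Leads.single ?_)
      (ih (emb ∘ some) (emb none) fun l => hM (some l))) (ih' emb exit hM)
    rw [step_cfg, hM, cfg_update]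
    change some (cond (p (f v (S w).head?)) _ _) = _
    rw [hp]
    rfl
  | mono _ hle ih =>
    obtain ⟨n, hn, h⟩ := ih emb exit hM
    exact ⟨n, hn.trans hle, h⟩

/-- The machine that runs `c` with the input on the stack `inp`. -/
def machine [Fintype W] [Fintype σ] (c : Cmd W σ) (inp : W) (init : σ) :
    Turing.TM2ComputableAux Bool (Option Bool) where
  tm :=
    { K := Option W
      k₀ := some inp
      k₁ := none
      Γ := Alph W
      Λ := Option (Lab c)
      main := some (start c)
      σ := σ
      initialState := init
      Γk₀Fin := inferInstanceAs (Fintype Bool)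
      m := fun l => match l with
        | none => .halt
        | some l => compile c some none l }
  inputAlphabet := Equiv.refl Bool
  outputAlphabet := Equiv.refl (Option Bool)

/-- A halting configuration of `TM2` carries the initial control state and has all stacks but the
output empty. Hence the program must clean up after itself and restore its control state. The
additional step executes the halt statement. -/
theorem machine_outputsWithin [Fintype W] [Fintype σ] {c : Cmd W σ} {inp : W} {init : σ}
    {x : List Bool} {y : List (Option Bool)} {t : ℕ}
    (h : Exec c ⟨init, Function.update (fun _ => []) inp x, []⟩ ⟨init, fun _ => [], y⟩ t) :
    OutputsWithin (machine c inp init) x y (t + 1) := by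
  obtain ⟨n, hn, h⟩ := (h.leads (machine c inp init).tm.m some none fun _ => rfl).trans
    (Leads.single (b := cfg none ⟨init, fun _ => [], y⟩) rfl)
  refine ⟨⟨⟨n, ?_⟩, hn⟩⟩
  have h1 : Turing.initList (machine c inp init).tm (x.map (machine c inp init).inputAlphabet.symm)
      = cfg (some (some (start c))) ⟨init, Function.update (fun _ => []) inp x, []⟩ := by
    unfold Turing.initList cfg
    congr 1
    funext k
    cases k with
    | none => rfl
    | some k =>
      by_cases hk : k = inp
      · subst hk
        simp only [allStk, Function.update_self]
        exact (dif_pos rfl).trans (List.map_id x)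
      · simp only [allStk, Function.update_of_ne hk]
        exact dif_neg (by simpa [machine] using hk)
  have h2 : Turing.haltList (machine c inp init).tm
      (y.map (machine c inp init).outputAlphabet.symm)
      = cfg none ⟨init, fun _ => [], y⟩ := by
    unfold Turing.haltList cfg
    congr 1
    funext k
    cases k with
    | none => exact (dif_pos rfl).trans (List.map_id y)
    | some k => exact dif_neg (by simp [machine])
  simp only [Option.map_some]
  rw [h1, h2]
  exact h

end Cmd

/-! ### Registers and basic programs -/

/-- The work stacks of the listing program. -/
inductive Reg
  | inp | un | adj | col | row | kk | nn | bad | ida | ida2 | rk | rk2 | den | uu | ww | i | j | tmp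
  deriving DecidableEq

instance : Fintype Reg :=
  ⟨{.inp, .un, .adj, .col, .row, .kk, .nn, .bad, .ida, .ida2, .rk, .rk2, .den, .uu, .ww, .i, .j, .tmp},
    by rintro ⟨⟩ <;> decide⟩

/-- The finite control state: the bit read last, the number of neighbours seen so far (up to two),
a saved bit, a parity, the result of a comparison, and a carry. -/
structure Var where
  reg : Option Bool
  seen : Fin 3
  x : Bool
  par : Bool
  eq : Bool
  carry : Bool

instance : Fintype Var :=
  Fintype.ofEquiv (Option Bool × Fin 3 × Bool × Bool × Bool × Bool)
    { toFun := fun p => ⟨p.1, p.2.1, p.2.2.1, p.2.2.2.1, p.2.2.2.2.1, p.2.2.2.2.2⟩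
      invFun := fun v => (v.reg, v.seen, v.x, v.par, v.eq, v.carry)
      left_inv := fun _ => rfl
      right_inv := fun _ => rfl }

/-- The contents of the work stacks. -/
structure Stacks where
  inp : List Bool := []
  un : List Bool := []
  adj : List Bool := []
  col : List Bool := []
  row : List Bool := []
  kk : List Bool := []
  nn : List Bool := []
  bad : List Bool := []
  ida : List Bool := []
  ida2 : List Bool := []
  rk : List Bool := []
  rk2 : List Bool := []
  den : List Bool := []
  uu : List Bool := []
  ww : List Bool := []
  i : List Bool := []
  j : List Bool := []
  tmp : List Bool := []

namespace Stacks

/-- The content of one work stack. -/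
def get (s : Stacks) : Reg → List Bool
  | .inp => s.inp | .un => s.un | .adj => s.adj | .col => s.col | .row => s.row | .kk => s.kk
  | .nn => s.nn | .bad => s.bad | .ida => s.ida | .ida2 => s.ida2 | .rk => s.rk | .rk2 => s.rk2
  | .den => s.den | .uu => s.uu | .ww => s.ww | .i => s.i | .j => s.j | .tmp => s.tmp

/-- Replace the content of one work stack. -/
def set (s : Stacks) (w : Reg) (l : List Bool) : Stacks :=
  match w with
  | .inp => { s with inp := l } | .un => { s with un := l } | .adj => { s with adj := l }
  | .col => { s with col := l } | .row => { s with row := l } | .kk => { s with kk := l }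
  | .nn => { s with nn := l } | .bad => { s with bad := l } | .ida => { s with ida := l }
  | .ida2 => { s with ida2 := l } | .rk => { s with rk := l } | .rk2 => { s with rk2 := l }
  | .den => { s with den := l } | .uu => { s with uu := l } | .ww => { s with ww := l }
  | .i => { s with i := l } | .j => { s with j := l } | .tmp => { s with tmp := l }

/-- Stack contents are kept as a record, so that concrete memories can be compared by `rfl` and
`simp`; this translates the functional updates of `Exec` into record updates. -/
theorem update_get (s : Stacks) (w : Reg) (l : List Bool) :
    Function.update s.get w l = (s.set w l).get := by
  funext k
  cases w <;> cases k <;> rfl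

theorem get_set_self (s : Stacks) (w : Reg) (l : List Bool) : (s.set w l).get w = l := by
  cases w <;> rfl

theorem get_set_of_ne (s : Stacks) {w k : Reg} (h : k ≠ w) (l : List Bool) :
    (s.set w l).get k = s.get k := by
  rw [← update_get, Function.update_of_ne h]

theorem set_set (s : Stacks) (w : Reg) (l l' : List Bool) : (s.set w l).set w l' = s.set w l' := by
  cases w <;> rfl

theorem set_get (s : Stacks) (w : Reg) : s.set w (s.get w) = s := by
  cases w <;> rfl

theorem set_comm (s : Stacks) {w k : Reg} (h : k ≠ w) (l l' : List Bool) :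
    (s.set w l).set k l' = (s.set k l').set w l := by
  cases w <;> cases k <;> first | rfl | exact absurd rfl h

end Stacks

/-- Commands of the listing program. -/
abbrev Prog := Cmd Reg Var

/-- `Runs c v s o v' s' o' t`: from the control state `v`, the stacks `s` and the output `o` the
command `c` leads to `v'`, `s'` and `o'` within `t` steps. -/
def Runs (c : Prog) (v : Var) (s : Stacks) (o : List (Option Bool)) (v' : Var) (s' : Stacks)
    (o' : List (Option Bool)) (t : ℕ) : Prop :=
  Cmd.Exec c ⟨v, s.get, o⟩ ⟨v', s'.get, o'⟩ t

namespace Prog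

infixr:60 " ;; " => Cmd.seq

/-- Push the bit read last. -/
def pushReg (w : Reg) : Prog := .push w fun v => v.reg.getD false

/-- Push a constant. -/
def pushBit (w : Reg) (b : Bool) : Prog := .push w fun _ => b

/-- Emit the bit read last. -/
def emitReg : Prog := .emit fun v => some (v.reg.getD false)

/-- Emit a separator. -/
def emitSep : Prog := .emit fun _ => none

/-- Read a bit. -/
def popReg (w : Reg) : Prog := .pop w fun v a => { v with reg := a }

/-- Read the bits of a stack one after the other until it is empty. -/
def forEach (w : Reg) (c : Prog) : Prog :=
  .loop w (fun v a => { v with reg := a }) (fun v => v.reg.isSome) c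

variable {c c' : Prog} {v v' v'' : Var} {s s' s'' : Stacks} {o o' o'' : List (Option Bool)}
  {t t' : ℕ}

theorem _root_.Runs.seq (h : Runs c v s o v' s' o' t) (h' : Runs c' v' s' o' v'' s'' o'' t') :
    Runs (c ;; c') v s o v'' s'' o'' (t + t') :=
  Cmd.Exec.seq h h'

theorem _root_.Runs.mono (h : Runs c v s o v' s' o' t) (ht : t ≤ t') :
    Runs c v s o v' s' o' t' :=
  Cmd.Exec.mono h ht

theorem _root_.Runs.cast (h : Runs c v s o v' s' o' t) (hv : v' = v'') (hs : s' = s'')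
    (ho : o' = o'') : Runs c v s o v'' s'' o'' t := by
  subst hv hs ho
  exact h

theorem runs_push (w : Reg) (f : Var → Bool) (v : Var) (s : Stacks) (o : List (Option Bool)) :
    Runs (.push w f) v s o v (s.set w (f v :: s.get w)) o 1 := by
  have h := Cmd.Exec.push w f v s.get o
  rwa [Stacks.update_get] at h

theorem runs_pushReg (w : Reg) (v : Var) (x : Bool) (s : Stacks) (o : List (Option Bool))
    (hv : v.reg = some x) : Runs (pushReg w) v s o v (s.set w (x :: s.get w)) o 1 := by
  have h := runs_push w (fun v => v.reg.getD false) v s o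
  rwa [hv] at h

theorem runs_pushBit (w : Reg) (b : Bool) (v : Var) (s : Stacks) (o : List (Option Bool)) :
    Runs (pushBit w b) v s o v (s.set w (b :: s.get w)) o 1 :=
  runs_push w (fun _ => b) v s o

theorem runs_emitReg (v : Var) (x : Bool) (s : Stacks) (o : List (Option Bool))
    (hv : v.reg = some x) : Runs emitReg v s o v s (some x :: o) 1 := by
  have h := Cmd.Exec.emit (fun v : Var => some (v.reg.getD false)) v s.get o
  rwa [hv] at h

theorem runs_emitSep (v : Var) (s : Stacks) (o : List (Option Bool)) :
    Runs emitSep v s o v s (none :: o) 1 :=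
  Cmd.Exec.emit _ v s.get o

theorem runs_popReg (w : Reg) (v : Var) (x : Bool) (l : List Bool) (s : Stacks)
    (o : List (Option Bool)) (hs : s.get w = x :: l) :
    Runs (popReg w) v s o { v with reg := some x } (s.set w l) o 1 := by
  have h := Cmd.Exec.pop w (fun (v : Var) a => { v with reg := a }) v s.get o
  rwa [hs, Stacks.update_get] at h

theorem runs_load (f : Var → Var) (v : Var) (s : Stacks) (o : List (Option Bool)) :
    Runs (.load f) v s o (f v) s o 1 :=
  Cmd.Exec.load f v s.get o

theorem runs_ite_true (p : Var → Bool) (h : p v = true) (hc : Runs c v s o v' s' o' t) :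
    Runs (.ite p c c') v s o v' s' o' (1 + t) :=
  Cmd.Exec.ite_true h hc

theorem runs_ite_false (p : Var → Bool) (h : p v = false) (hc : Runs c' v s o v' s' o' t) :
    Runs (.ite p c c') v s o v' s' o' (1 + t) :=
  Cmd.Exec.ite_false h hc

/-- The invariant rule for loops: the memory is a function of the items `d` already treated and the
items `r` to come. An item may carry more than the bit `π x` found on the loop stack, which lets a
loop consume several stacks in parallel. The bit read last is left free, since the next guard
overwrites it. -/
theorem runs_forEach_map {α : Type} {w : Reg} {c : Prog} (π : α → Bool) (k : ℕ)
    (v : List α → Var) (s : List α → List α → Stacks) (o : List α → List (Option Bool))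
    (l : List α) (hs : ∀ d r, (s d r).get w = r.map π)
    (hstep : ∀ d x r, l = d ++ x :: r → ∃ ρ,
      Runs c { v d with reg := some (π x) } ((s d (x :: r)).set w (r.map π)) (o d)
        { v (d ++ [x]) with reg := ρ } (s (d ++ [x]) r) (o (d ++ [x])) k) (ρ : Option Bool) :
    Runs (forEach w c) { v [] with reg := ρ } (s [] l) (o []) { v l with reg := none } (s l [])
      (o l) (l.length * (k + 1) + 1) := by
  -- The induction is on the remaining items and needs an arbitrary split of `l`.
  suffices H : ∀ r d ρ, l = d ++ r →
      Runs (forEach w c) { v d with reg := ρ } (s d r) (o d) { v l with reg := none } (s l [])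
        (o l) (r.length * (k + 1) + 1) from H l [] ρ rfl
  intro r
  induction r with
  | nil =>
    intro d ρ hd
    rw [List.append_nil] at hd
    subst hd
    have h := Cmd.Exec.loop_exit (w := w) (f := fun (v : Var) a => { v with reg := a })
      (p := fun v => v.reg.isSome) (body := c) (v := { v l with reg := ρ }) (S := (s l []).get)
      (o := o l) (by simp [hs])
    rw [hs, Stacks.update_get, List.map_nil, List.tail_nil] at h
    have e : (s l []).set w [] = s l [] := by
      conv_rhs => rw [← Stacks.set_get (s l []) w, hs]
      rfl
    rw [e] at h
    exact h.mono (by omega)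
  | cons x r ih =>
    intro d ρ hd
    obtain ⟨ρ', h1⟩ := hstep d x r hd
    have h2 := ih (d ++ [x]) ρ' (by simp [hd])
    have h := Cmd.Exec.loop_step (w := w) (f := fun (v : Var) a => { v with reg := a })
      (p := fun v => v.reg.isSome) (body := c) (v := { v d with reg := ρ })
      (S := (s d (x :: r)).get) (o := o d) (by simp [hs]) (t := k) (s' := _)
      (by rw [hs, Stacks.update_get]; exact h1) h2
    refine Cmd.Exec.mono h ?_
    rw [List.length_cons]
    linarith

theorem runs_forEach {w : Reg} {c : Prog} (k : ℕ) (v : List Bool → Var)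
    (s : List Bool → List Bool → Stacks) (o : List Bool → List (Option Bool)) (l : List Bool)
    (hs : ∀ d r, (s d r).get w = r)
    (hstep : ∀ d x r, l = d ++ x :: r → ∃ ρ,
      Runs c { v d with reg := some x } ((s d (x :: r)).set w r) (o d)
        { v (d ++ [x]) with reg := ρ } (s (d ++ [x]) r) (o (d ++ [x])) k) (ρ : Option Bool) :
    Runs (forEach w c) { v [] with reg := ρ } (s [] l) (o []) { v l with reg := none } (s l [])
      (o l) (l.length * (k + 1) + 1) :=
  runs_forEach_map id k v s o l (fun d r => by rw [hs, List.map_id])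
    (fun d x r h => by rw [List.map_id]; exact hstep d x r h) ρ

/-! ### Moving and copying -/

/-- Move the content of `a` to `b`, reversing it. -/
def move (a b : Reg) : Prog := forEach a (pushReg b)

theorem runs_move {a b : Reg} (hab : a ≠ b) (v : Var) (s : Stacks) (o : List (Option Bool)) :
    Runs (move a b) v s o { v with reg := none }
      ((s.set a []).set b ((s.get a).reverse ++ s.get b)) o ((s.get a).length * 2 + 1) := by
  have h := runs_forEach (w := a) (c := pushReg b) 1 (fun _ => v)
    (fun d r => (s.set b (d.reverse ++ s.get b)).set a r) (fun _ => o) (s.get a)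
    (fun d r => Stacks.get_set_self _ _ _) (fun d x r _ => ⟨some x, by
      have h := runs_pushReg b { v with reg := some x } x
        ((s.set b (d.reverse ++ s.get b)).set a r) o rfl
      rw [Stacks.set_set]
      convert h using 1
      rw [Stacks.get_set_of_ne _ hab.symm, Stacks.get_set_self, Stacks.set_comm _ hab.symm,
        Stacks.set_set]
      simp⟩) v.reg
  simp only [List.reverse_nil, List.nil_append, Stacks.set_get] at h
  rwa [Stacks.set_comm _ hab.symm]

/-- Empty a stack. -/
def clear (a : Reg) : Prog := forEach a (.load id)

theorem runs_clear (a : Reg) (v : Var) (s : Stacks) (o : List (Option Bool)) :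
    Runs (clear a) v s o { v with reg := none } (s.set a []) o ((s.get a).length * 2 + 1) := by
  have h := runs_forEach (w := a) (c := .load id) 1 (fun _ => v)
    (fun d r => s.set a r) (fun _ => o) (s.get a)
    (fun d r => Stacks.get_set_self _ _ _) (fun d x r _ => ⟨some x, by
      rw [Stacks.set_set]
      exact runs_load id { v with reg := some x } (s.set a r) o⟩) v.reg
  rwa [Stacks.set_get] at h

/-- Move the content of `a` to the output, reversing it. -/
def emitAll (a : Reg) : Prog := forEach a emitReg

theorem runs_emitAll (a : Reg) (v : Var) (s : Stacks) (o : List (Option Bool)) :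
    Runs (emitAll a) v s o { v with reg := none } (s.set a [])
      ((s.get a).reverse.map some ++ o) ((s.get a).length * 2 + 1) := by
  have h := runs_forEach (w := a) (c := emitReg) 1 (fun _ => v)
    (fun d r => s.set a r) (fun d => d.reverse.map some ++ o) (s.get a)
    (fun d r => Stacks.get_set_self _ _ _) (fun d x r _ => ⟨some x, by
      rw [Stacks.set_set]
      simpa using runs_emitReg { v with reg := some x } x (s.set a r)
        (d.reverse.map some ++ o) rfl⟩) v.reg
  rwa [Stacks.set_get] at h

/-- Copy the content of `a` on top of `b`, through the empty stack `t`. -/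
def copy (a b t : Reg) : Prog := move a t ;; forEach t (pushReg a ;; pushReg b)

/-- Moving to `t` reverses the word and pushing back reverses it again, so the original order is
restored on `a` and put on `b`. -/
theorem runs_copy {a b t : Reg} (hab : a ≠ b) (hat : a ≠ t) (hbt : b ≠ t) (v : Var) (s : Stacks)
    (o : List (Option Bool)) (ht : s.get t = []) :
    Runs (copy a b t) v s o { v with reg := none } (s.set b (s.get a ++ s.get b)) o
      ((s.get a).length * 5 + 2) := by
  have h1 := runs_move hat v s o
  have h2 := runs_forEach (w := t) (c := pushReg a ;; pushReg b) 2 (fun _ => v)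
    (fun d r => ((s.set a d.reverse).set b (d.reverse ++ s.get b)).set t r) (fun _ => o)
    (s.get a).reverse
    (fun d r => Stacks.get_set_self _ _ _) (fun d x r _ => ⟨some x, by
      have h := (runs_pushReg a { v with reg := some x } x
        (((s.set a d.reverse).set b (d.reverse ++ s.get b)).set t r) o rfl).seq
        (runs_pushReg b { v with reg := some x } x _ o rfl)
      rw [Stacks.set_set]
      convert h using 1
      rw [Stacks.get_set_of_ne _ hat, Stacks.get_set_of_ne _ hab, Stacks.get_set_self,
        Stacks.get_set_of_ne _ hab.symm, Stacks.get_set_of_ne _ hbt, Stacks.get_set_self,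
        Stacks.set_comm _ hat, Stacks.set_comm _ hbt, Stacks.set_comm _ hab, Stacks.set_set,
        Stacks.set_set]
      simp⟩) none
  rw [ht, List.append_nil] at h1
  have e1 : ((s.set a (([] : List Bool).reverse)).set b (([] : List Bool).reverse ++ s.get b)).set t
      (s.get a).reverse = (s.set a []).set t (s.get a).reverse := by
    rw [List.reverse_nil, List.nil_append]
    congr 1
    conv_lhs => rw [← Stacks.get_set_of_ne s hab.symm [], Stacks.set_get]
  rw [e1] at h2
  refine (h1.seq ?_).mono (t := ((s.get a).length * 2 + 1) + ((s.get a).length * 3 + 1)) (by omega)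
  have e2 : ((s.set a ((s.get a).reverse.reverse)).set b
      ((s.get a).reverse.reverse ++ s.get b)).set t [] = s.set b (s.get a ++ s.get b) := by
    rw [List.reverse_reverse, Stacks.set_get]
    have := Stacks.set_get (s.set b (s.get a ++ s.get b)) t
    rwa [Stacks.get_set_of_ne _ hbt.symm, ht] at this
  rw [e2, List.length_reverse] at h2
  exact h2

/-! ### Binary numbers -/

/-- The successor of a binary number, least significant bit first. -/
def incBits : List Bool → List Bool
  | [] => [true]
  | false :: l => true :: l
  | true :: l => false :: incBits l

/-- Increment the binary number on `k`, through the empty stack `t`. -/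
def inc (k t : Reg) : Prog :=
  .load (fun v => { v with carry := true }) ;;
  forEach k (.push t (fun v => xor (v.reg.getD false) v.carry) ;;
    .load fun v => { v with carry := v.carry && v.reg.getD false }) ;;
  .ite (fun v => v.carry) (pushBit t true) (.load id) ;;
  .load (fun v => { v with carry := false }) ;;
  move t k

/-- The bits `d` after an increment, without the final carry. -/
def incFixed : Bool → List Bool → List Bool
  | _, [] => []
  | c, b :: l => xor b c :: incFixed (c && b) l

theorem incFixed_false (l : List Bool) : incFixed false l = l := by
  induction l with
  | nil => rfl
  | cons b l ih => simp [incFixed, ih]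

theorem incFixed_append (c : Bool) (d : List Bool) (x : Bool) :
    incFixed c (d ++ [x]) = incFixed c d ++ [xor x (c && d.all id)] := by
  induction d generalizing c with
  | nil => simp [incFixed]
  | cons b d ih => simp [incFixed, ih, Bool.and_assoc]

/-- The carry leaves the top of the number exactly when all its digits are one; only then does the
number get longer. -/
theorem incBits_eq (l : List Bool) :
    incBits l = incFixed true l ++ if l.all id then [true] else [] := by
  induction l with
  | nil => rfl
  | cons b l ih => cases b <;> simp [incBits, incFixed, incFixed_false, ih]

theorem runs_inc {k t : Reg} (hkt : k ≠ t) (v : Var) (s : Stacks) (o : List (Option Bool))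
    (ht : s.get t = []) :
    Runs (inc k t) v s o { v with reg := none, carry := false } (s.set k (incBits (s.get k))) o
      ((s.get k).length * 5 + 8) := by
  have h1 := runs_load (fun v => { v with carry := true }) v s o
  have h2 := runs_forEach (w := k) (c := .push t (fun v => xor (v.reg.getD false) v.carry) ;;
      .load fun v => { v with carry := v.carry && v.reg.getD false }) 2
    (fun d => { v with carry := d.all id })
    (fun d r => (s.set t (incFixed true d).reverse).set k r) (fun _ => o) (s.get k)
    (fun d r => Stacks.get_set_self _ _ _) (fun d x r _ => ⟨some x, by
      have h := (runs_push t (fun v => xor (v.reg.getD false) v.carry)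
        { v with reg := some x, carry := d.all id }
        ((s.set t (incFixed true d).reverse).set k r) o).seq
        (runs_load (fun v => { v with carry := v.carry && v.reg.getD false }) _ _ o)
      rw [Stacks.set_set]
      convert h using 1
      · simp
      · rw [Stacks.get_set_of_ne _ hkt.symm, Stacks.get_set_self, Stacks.set_comm _ hkt.symm,
          Stacks.set_set, incFixed_append]
        simp⟩) v.reg
  have e1 : (s.set t (incFixed true []).reverse).set k (s.get k) = s := by
    have := Stacks.set_get s t
    rw [ht] at this
    rw [incFixed, List.reverse_nil, this, Stacks.set_get]
  simp only [List.all_nil, e1] at h2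
  -- The digits stand reversed on `t`, so the surviving carry is pushed on top as the most
  -- significant one.
  have h3 : Runs (.ite (fun v => v.carry) (pushBit t true) (.load id))
      { v with reg := none, carry := (s.get k).all id }
      ((s.set t (incFixed true (s.get k)).reverse).set k []) o
      { v with reg := none, carry := (s.get k).all id }
      ((s.set t (incBits (s.get k)).reverse).set k []) o (1 + 1) := by
    rw [incBits_eq]
    cases hc : (s.get k).all id
    · refine runs_ite_false (fun v => v.carry) rfl ?_
      simp only [Bool.false_eq_true, if_false, List.append_nil]
      exact runs_load id _ _ o
    · refine runs_ite_true (fun v => v.carry) rfl ?_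
      convert runs_pushBit t true _ _ o using 1
      rw [Stacks.get_set_of_ne _ hkt.symm, Stacks.get_set_self, Stacks.set_comm _ hkt.symm,
          Stacks.set_set]
      simp
  have h4 := runs_load (fun v => { v with carry := false })
    { v with reg := none, carry := (s.get k).all id }
    ((s.set t (incBits (s.get k)).reverse).set k []) o
  have h5 := runs_move hkt.symm { v with reg := none, carry := false }
    ((s.set t (incBits (s.get k)).reverse).set k []) o
  rw [Stacks.get_set_of_ne _ hkt.symm, Stacks.get_set_self, Stacks.get_set_self,
    List.reverse_reverse, List.append_nil, Stacks.set_comm _ hkt.symm, Stacks.set_set,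
    Stacks.set_set, List.length_reverse] at h5
  have e2 : (s.set t []).set k (incBits (s.get k)) = s.set k (incBits (s.get k)) := by
    rw [← ht, Stacks.set_get]
  rw [e2] at h5
  have hlen : (incBits (s.get k)).length ≤ (s.get k).length + 1 := by
    generalize s.get k = l
    induction l with
    | nil => simp [incBits]
    | cons b l ih => cases b <;> simp [incBits, ih]
  refine ((((h1.seq (h2.seq (h3.seq (h4.seq h5)))))).mono ?_)
  omega

/-- Emit the bits of `k`, most significant bit first, keeping them. -/
def emitKeep (k t : Reg) : Prog := move k t ;; forEach t (emitReg ;; pushReg k)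

theorem runs_emitKeep {k t : Reg} (hkt : k ≠ t) (v : Var) (s : Stacks) (o : List (Option Bool))
    (ht : s.get t = []) :
    Runs (emitKeep k t) v s o { v with reg := none } s ((s.get k).map some ++ o)
      ((s.get k).length * 5 + 2) := by
  have h1 := runs_move hkt v s o
  have h2 := runs_forEach (w := t) (c := emitReg ;; pushReg k) 2 (fun _ => v)
    (fun d r => (s.set k d.reverse).set t r) (fun d => d.reverse.map some ++ o)
    (s.get k).reverse
    (fun d r => Stacks.get_set_self _ _ _) (fun d x r _ => ⟨some x, by
      have h := (runs_emitReg { v with reg := some x } x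
        ((s.set k d.reverse).set t r) (d.reverse.map some ++ o) rfl).seq
        (runs_pushReg k { v with reg := some x } x _ _ rfl)
      rw [Stacks.set_set]
      convert h using 1
      · rw [Stacks.get_set_of_ne _ hkt, Stacks.get_set_self, Stacks.set_comm _ hkt,
          Stacks.set_set]
        simp
      · simp⟩) none
  rw [ht, List.append_nil] at h1
  have e2 : (s.set k (s.get k).reverse.reverse).set t [] = s := by
    rw [List.reverse_reverse, Stacks.set_get, ← ht, Stacks.set_get]
  rw [e2, List.length_reverse, List.reverse_reverse] at h2
  exact (h1.seq h2).mono (by omega)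

theorem runs_copy_nil {a b t : Reg} (hab : a ≠ b) (hat : a ≠ t) (hbt : b ≠ t) (v : Var)
    (s : Stacks) (o : List (Option Bool)) (ht : s.get t = []) (hb : s.get b = []) :
    Runs (copy a b t) v s o { v with reg := none } (s.set b (s.get a)) o
      ((s.get a).length * 5 + 2) := by
  have h := runs_copy hab hat hbt v s o ht
  rwa [hb, List.append_nil] at h

theorem runs_pop (w : Reg) (v : Var) (s : Stacks) (o : List (Option Bool)) :
    Runs (popReg w) v s o { v with reg := (s.get w).head? } (s.set w (s.get w).tail) o 1 := by
  have h := Cmd.Exec.pop w (fun (v : Var) a => { v with reg := a }) v s.get o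
  rwa [Stacks.update_get] at h

end Prog

/-! ### Words occurring in the listing -/

/-- The last `n` binary digits of `x`, least significant first. -/
def bitsW : ℕ → ℕ → List Bool
  | 0, _ => []
  | n + 1, x => decide (x % 2 = 1) :: bitsW n (x / 2)

theorem length_bitsW (n x : ℕ) : (bitsW n x).length = n := by
  induction n generalizing x with
  | zero => rfl
  | succ n ih => simp [bitsW, ih]

theorem bitsW_zero (n : ℕ) : bitsW n 0 = List.replicate n false := by
  induction n with
  | zero => rfl
  | succ n ih => simp [bitsW, ih, List.replicate_succ]

theorem bitsW_inj {n x y : ℕ} (hx : x < 2 ^ n) (hy : y < 2 ^ n) (h : bitsW n x = bitsW n y) :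
    x = y := by
  induction n generalizing x y with
  | zero => omega
  | succ n ih =>
    simp only [bitsW, List.cons.injEq, decide_eq_decide] at h
    have := ih (x := x / 2) (y := y / 2) (by omega) (by omega) h.2
    omega

/-- The bound on `x` excludes an overflow, so the width stays `n`. -/
theorem incBits_bitsW {n x : ℕ} (hx : x + 1 < 2 ^ n) : Prog.incBits (bitsW n x) = bitsW n (x + 1) := by
  induction n generalizing x with
  | zero => omega
  | succ n ih =>
    rcases Nat.mod_two_eq_zero_or_one x with h | h
    · have h1 : (x + 1) % 2 = 1 := by omega
      have h2 : (x + 1) / 2 = x / 2 := by omega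
      simp [bitsW, h, h1, h2, Prog.incBits]
    · have h1 : (x + 1) % 2 = 0 := by omega
      have h2 : (x + 1) / 2 = x / 2 + 1 := by omega
      simp [bitsW, h, h1, h2, Prog.incBits, ih (x := x / 2) (by omega)]

theorem incBits_bits (n : ℕ) : Prog.incBits n.bits = (n + 1).bits := by
  induction n using Nat.strong_induction_on with
  | _ n ih =>
    rcases Nat.even_or_odd' n with ⟨k, rfl | rfl⟩
    · rcases Nat.eq_zero_or_pos k with rfl | hk
      · simp [Prog.incBits]
      · rw [Nat.bit0_bits k hk.ne', Nat.bit1_bits]; rfl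
    · rw [Nat.bit1_bits, Prog.incBits, ih k (by omega), show 2 * k + 1 + 1 = 2 * (k + 1) by ring,
        Nat.bit0_bits _ (by omega)]

/-- The inner product modulo 2. -/
def innerL : List Bool → List Bool → Bool
  | x :: l, y :: l' => xor (x && y) (innerL l l')
  | _, _ => false

/-- Extends the inner product at the far end, as needed for a loop invariant about the digits
already read. -/
theorem innerL_append {d d' : List Bool} (h : d.length = d'.length) (x y : Bool) :
    innerL (d ++ [x]) (d' ++ [y]) = xor (innerL d d') (x && y) := by
  induction d generalizing d' with
  | nil => cases d' <;> simp_all [innerL]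
  | cons b d ih =>
    cases d' with
    | nil => simp at h
    | cons b' d' => simp [innerL, ih (by simpa using h)]

/-- The inner product modulo 2 of the last `n` binary digits. -/
def inner2 (n x y : ℕ) : Bool := innerL (bitsW n x) (bitsW n y)

/-- Keep the `true` entries of `l` whose number of predecessors, counted from `s`, satisfies `f`. -/
def marks (f : ℕ → Bool) : ℕ → List Bool → List Bool
  | _, [] => []
  | s, b :: l => (b && f s) :: marks f (s + b.toNat) l

theorem length_marks (f : ℕ → Bool) (s : ℕ) (l : List Bool) : (marks f s l).length = l.length := by
  induction l generalizing s with
  | nil => rfl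
  | cons b l ih => simp [marks, ih]

theorem marks_append (f : ℕ → Bool) (s : ℕ) (d : List Bool) (x : Bool) :
    marks f s (d ++ [x]) = marks f s d ++ [x && f (s + d.count true)] := by
  induction d generalizing s with
  | nil => simp [marks]
  | cons b d ih => cases b <;> simp [marks, ih, Nat.add_assoc, Nat.add_comm 1]

/-- Whether the neighbour of position `s` belongs to the left side of the rectangle number `a`. -/
def leftAt (m a s : ℕ) : Bool :=
  decide (s = 0) || (decide (2 ≤ s) && !decide (a = s - 2) && !inner2 m a (s - 2))

/-- Whether the neighbour of position `s` belongs to the right side of the rectangle number `a`. -/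
def rightAt (m a s : ℕ) : Bool :=
  decide (s = 1) || (decide (2 ≤ s) && !decide (a = s - 2) && inner2 m a (s - 2))

/-- The output word of the rectangle number `a` of a vertex with the adjacency row `row`. -/
def entryWord (m n : ℕ) (row : List Bool) (a : ℕ) : List (Option Bool) :=
  (marks (leftAt m a) 0 row).map some ++ none :: ((marks (rightAt m a) 0 row).map some ++
    none :: some true :: none :: (((row.count true - 2) * n).bits.map some ++ [none]))

/-- The output word of all rectangles of a vertex with the adjacency row `row`. -/
def rowWord (m n : ℕ) (row : List Bool) : List (Option Bool) :=
  (List.range (row.count true - 2)).reverse.flatMap (entryWord m n row)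

/-! ### The listing program -/

namespace Prog

/-- Compute the inner product of `ida` and `rk`, and compare them. -/
def compare : Prog :=
  .load (fun v => { v with par := false, eq := true }) ;;
  forEach .ida (.load (fun v => { v with x := v.reg.getD false }) ;;
    .push .ida2 (fun v => v.x) ;; popReg .rk ;; pushReg .rk2 ;;
    .load fun v => { v with
      par := xor v.par (v.x && v.reg.getD false)
      eq := v.eq && (v.x == v.reg.getD false) }) ;;
  forEach .ida2 (pushReg .ida ;; popReg .rk2 ;; pushReg .rk) ;;
  .load fun v => { v with x := false }

/-- Both numbers are read digit by digit onto auxiliary stacks and then put back, so that the stacks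
end as they began. Equal lengths let a single loop consume both. -/
theorem runs_compare (v : Var) (s : Stacks) (o : List (Option Bool)) (hv : v.x = false)
    (h1 : s.ida2 = []) (h2 : s.rk2 = []) (hl : s.ida.length = s.rk.length) :
    Runs compare v s o
      { v with reg := none, par := innerL s.ida s.rk, eq := decide (s.ida = s.rk) } s o
      (s.ida.length * 10 + 4) := by
  obtain ⟨inp, un, adj, col, row, kk, nn, bad, x, x', y, y', den, uu, ww, i, j, t⟩ := s
  obtain ⟨ρ, seen, vx, par, eq, carry⟩ := v
  simp only at h1 h2 hl hv ⊢
  subst h1 h2 hv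
  have r1 := runs_load (fun v => { v with par := false, eq := true })
    ⟨ρ, seen, false, par, eq, carry⟩
    ⟨inp, un, adj, col, row, kk, nn, bad, x, [], y, [], den, uu, ww, i, j, t⟩ o
  -- The items are pairs of digits. The saved bit is the last digit of `ida` treated so far, with
  -- `false` as the initial default.
  have r2 := runs_forEach_map (w := .ida)
    (c := .load (fun v => { v with x := v.reg.getD false }) ;;
    .push .ida2 (fun v => v.x) ;; popReg .rk ;; pushReg .rk2 ;;
    .load fun v => { v with
      par := xor v.par (v.x && v.reg.getD false)
      eq := v.eq && (v.x == v.reg.getD false) }) Prod.fst 5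
    (fun d => ⟨none, seen, (d.map Prod.fst).getLast?.getD false,
      innerL (d.map Prod.fst) (d.map Prod.snd),
      decide (d.map Prod.fst = d.map Prod.snd), carry⟩)
    (fun d r => ⟨inp, un, adj, col, row, kk, nn, bad, r.map Prod.fst, (d.map Prod.fst).reverse,
      r.map Prod.snd, (d.map Prod.snd).reverse, den, uu, ww, i, j, t⟩) (fun _ => o) (x.zip y)
    (fun d r => rfl) (fun d p r _ => ⟨some p.2, by
      have e1 := runs_load (fun v => { v with x := v.reg.getD false })
        ⟨some p.1, seen, (d.map Prod.fst).getLast?.getD false,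
      innerL (d.map Prod.fst) (d.map Prod.snd),
      decide (d.map Prod.fst = d.map Prod.snd), carry⟩ ⟨inp, un, adj, col, row, kk, nn, bad, r.map Prod.fst, (d.map Prod.fst).reverse,
      p.2 :: r.map Prod.snd, (d.map Prod.snd).reverse, den, uu, ww, i, j, t⟩ o
      have e2 := e1.seq ((runs_push .ida2 (fun v => v.x) _ _ o).seq
        ((runs_popReg .rk _ p.2 (r.map Prod.snd) _ o rfl).seq
          ((runs_pushReg .rk2 _ p.2 _ o rfl).seq
            (runs_load (fun v => { v with
              par := xor v.par (v.x && v.reg.getD false)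
              eq := v.eq && (v.x == v.reg.getD false) }) _ _ o))))
      refine e2.cast ?_ ?_ rfl
      · simp only [List.map_append, List.map_cons, List.map_nil, Option.getD_some,
          List.getLast?_append, List.getLast?_singleton, Option.some_or]
        rw [innerL_append (by simp)]
        congr 1
        rw [Bool.eq_iff_iff]
        simp only [Bool.and_eq_true, decide_eq_true_eq, beq_iff_eq]
        rw [List.append_eq_append_iff_of_size_eq_left (by simp)]
        simp
      · simp [Stacks.set, Stacks.get]⟩) ρ
  rw [List.map_fst_zip hl.le, List.map_snd_zip hl.ge] at r2
  have r3 := runs_forEach_map (w := .ida2)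
    (c := pushReg .ida ;; popReg .rk2 ;; pushReg .rk) Prod.fst 3
    (fun _ => ⟨none, seen, x.getLast?.getD false, innerL x y, decide (x = y), carry⟩)
    (fun d r => ⟨inp, un, adj, col, row, kk, nn, bad, (d.map Prod.fst).reverse, r.map Prod.fst,
      (d.map Prod.snd).reverse, r.map Prod.snd, den, uu, ww, i, j, t⟩) (fun _ => o)
    (x.zip y).reverse
    (fun d r => rfl) (fun d p r _ => ⟨some p.2, by
      have e1 := (runs_pushReg .ida
        ⟨some p.1, seen, x.getLast?.getD false, innerL x y, decide (x = y), carry⟩ p.1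
        ⟨inp, un, adj, col, row, kk, nn, bad, (d.map Prod.fst).reverse, r.map Prod.fst,
      (d.map Prod.snd).reverse, p.2 :: r.map Prod.snd, den, uu, ww, i, j, t⟩ o rfl).seq
        ((runs_popReg .rk2 _ p.2 (r.map Prod.snd) _ o rfl).seq
          (runs_pushReg .rk _ p.2 _ o rfl))
      exact e1.cast rfl (by simp [Stacks.set, Stacks.get]) rfl⟩) none
  simp only [List.map_reverse, List.reverse_reverse] at r3
  rw [List.map_fst_zip hl.le, List.map_snd_zip hl.ge] at r3
  have r4 := runs_load (fun v => { v with x := false })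
    ⟨none, seen, x.getLast?.getD false, innerL x y, decide (x = y), carry⟩
    ⟨inp, un, adj, col, row, kk, nn, bad, x, [], y, [], den, uu, ww, i, j, t⟩ o
  refine (r1.seq (r2.seq (r3.seq r4))).mono ?_
  rw [List.length_reverse, List.length_zip, ← hl, min_self]
  omega

end Prog

/-! ### Sorting the neighbours of one vertex into the two sides of a rectangle. -/

namespace Prog

/-- The control state with the last bit `ρ` and `n` neighbours seen. -/
def seenVar (ρ : Option Bool) (n : ℕ) : Var :=
  ⟨ρ, if n = 0 then 0 else if n = 1 then 1 else 2, false, false, false, false⟩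

/-- Sort one vertex into the two sides of the rectangle. -/
def sortVertex : Prog :=
  .ite (fun v => v.reg.getD false)
    (.ite (fun v => decide (v.seen = 0))
      (pushBit .uu true ;; pushBit .ww false ;; .load fun v => { v with seen := 1 })
      (.ite (fun v => decide (v.seen = 1))
        (pushBit .uu false ;; pushBit .ww true ;; .load fun v => { v with seen := 2 })
        (compare ;; .push .uu (fun v => !v.eq && !v.par) ;; .push .ww (fun v => !v.eq && v.par) ;;
          .load (fun v => { v with par := false, eq := false }) ;; inc .rk .tmp)))
    (pushBit .uu false ;; pushBit .ww false)

/-- `rk` holds the rank of the next neighbour. The truncated `n - 2` keeps it at zero while the two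
fixed positions are passed, and it increases only afterwards. -/
theorem runs_sortVertex (m a n : ℕ) (x : Bool) (s : Stacks) (o : List (Option Bool))
    (hi2 : s.ida2 = []) (hr2 : s.rk2 = []) (ht : s.tmp = []) (hi : s.ida = bitsW m a)
    (hr : s.rk = bitsW m (n - 2)) (ha : a < 2 ^ m) (hn : n - 2 + 1 < 2 ^ m) :
    ∃ ρ, Runs sortVertex (seenVar (some x) n) s o (seenVar ρ (n + x.toNat))
      { s with
        rk := bitsW m (n + x.toNat - 2)
        uu := (x && leftAt m a n) :: s.uu
        ww := (x && rightAt m a n) :: s.ww } o (m * 15 + 18) := by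
  obtain ⟨inp, un, adj, col, row, kk, nn, bad, x1, x1', y1, y1', den, uu, ww, i, j, t⟩ := s
  simp only at hi2 hr2 ht hi hr
  subst hi2 hr2 ht hi hr
  cases x with
  | false =>
    refine ⟨some false, ?_⟩
    refine (runs_ite_false (fun v : Var => v.reg.getD false) rfl
      ((runs_pushBit .uu false _ _ o).seq (runs_pushBit .ww false _ _ o))).mono ?_
    omega
  | true =>
    rcases n with _ | _ | n
    · refine ⟨some true, ?_⟩
      refine Runs.mono (runs_ite_true (fun v : Var => v.reg.getD false) rfl
        (runs_ite_true (fun v : Var => decide (v.seen = 0)) rfl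
        ((runs_pushBit .uu true _ _ o).seq ((runs_pushBit .ww false _ _ o).seq
          (runs_load (fun v => { v with seen := 1 }) _ _ o))))) ?_
      omega
    · refine ⟨some true, ?_⟩
      refine Runs.mono (runs_ite_true (fun v : Var => v.reg.getD false) rfl
        (runs_ite_false (fun v : Var => decide (v.seen = 0)) rfl
        (runs_ite_true (fun v : Var => decide (v.seen = 1)) rfl
        ((runs_pushBit .uu false _ _ o).seq ((runs_pushBit .ww true _ _ o).seq
          (runs_load (fun v => { v with seen := 2 }) _ _ o)))))) ?_
      omega
    · refine ⟨none, ?_⟩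
      have h1 := runs_compare (seenVar (some true) (n + 2))
        ⟨inp, un, adj, col, row, kk, nn, bad, bitsW m a, [], bitsW m n, [], den, uu, ww, i, j, []⟩
        o rfl rfl rfl (by simp [length_bitsW])
      have h2 := h1.seq ((runs_push .uu (fun v => !v.eq && !v.par) _ _ o).seq
        ((runs_push .ww (fun v => !v.eq && v.par) _ _ o).seq
        ((runs_load (fun v => { v with par := false, eq := false }) _ _ o).seq
          (runs_inc (k := .rk) (t := .tmp) (by decide) _ _ o rfl))))
      -- Equality of digits is equality of numbers because both fit into `m` digits.
      have he : decide (bitsW m a = bitsW m n) = decide (a = n) := by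
        rw [decide_eq_decide]
        exact ⟨bitsW_inj ha (by omega), fun h => by rw [h]⟩
      refine Runs.mono ((runs_ite_true (fun v : Var => v.reg.getD false) rfl
        (runs_ite_false (fun v : Var => decide (v.seen = 0)) (by simp [seenVar])
        (runs_ite_false (fun v : Var => decide (v.seen = 1)) (by simp [seenVar]) h2))).cast
          (v'' := seenVar none (n + 2 + true.toNat)) ?_ ?_ rfl) ?_
      · simp [seenVar]
      · have : incBits (bitsW m n) = bitsW m (n + 1) := incBits_bitsW (by omega)
        simp [Stacks.set, Stacks.get, he, leftAt, rightAt, inner2, this]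
      · simp only [Stacks.set, Stacks.get, length_bitsW]
        omega

/-- Sort all vertices of the adjacency row into the two sides of the rectangle. -/
def sortRow : Prog :=
  copy .row .i .tmp ;; forEach .i sortVertex ;; .load fun v => { v with seen := 0 }

theorem runs_sortRow (m a : ℕ) (ρ : Option Bool) (s : Stacks) (o : List (Option Bool))
    (hi2 : s.ida2 = []) (hr2 : s.rk2 = []) (ht : s.tmp = []) (hi : s.ida = bitsW m a)
    (hr : s.rk = bitsW m 0) (hii : s.i = []) (hu : s.uu = []) (hw : s.ww = []) (ha : a < 2 ^ m)
    (hrow : s.row.length = m) :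
    Runs sortRow (seenVar ρ 0) s o (seenVar none 0)
      { s with
        rk := bitsW m (s.row.count true - 2)
        uu := (marks (leftAt m a) 0 s.row).reverse
        ww := (marks (rightAt m a) 0 s.row).reverse } o (m * (m * 15 + 24) + 4) := by
  obtain ⟨inp, un, adj, col, row, kk, nn, bad, x1, x1', y1, y1', den, uu, ww, i, j, t⟩ := s
  simp only at hi2 hr2 ht hi hr hii hu hw hrow
  subst hi2 hr2 ht hi hr hii hu hw
  have h1 := runs_copy_nil (a := .row) (b := .i) (t := .tmp) (by decide) (by decide) (by decide)
    (seenVar ρ 0)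
    ⟨inp, un, adj, col, row, kk, nn, bad, bitsW m a, [], bitsW m 0, [], den, [], [], [], j, []⟩
    o rfl rfl
  have h2 := runs_forEach (w := .i) (c := sortVertex) (m * 15 + 18)
    (fun d => seenVar none (d.count true))
    (fun d r => ⟨inp, un, adj, col, row, kk, nn, bad, bitsW m a, [], bitsW m (d.count true - 2),
      [], den, (marks (leftAt m a) 0 d).reverse, (marks (rightAt m a) 0 d).reverse, r, j, []⟩)
    (fun _ => o) row (fun _ _ => rfl) (fun d x r hd => by
      -- The prefix `d` is proper, so its count is below `m < 2 ^ m` and the rank can be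
      -- incremented.
      have hlt : d.count true - 2 + 1 < 2 ^ m := by
        have h3 := List.count_le_length (a := true) (l := d)
        have h4 := congrArg List.length hd
        rw [List.length_append, List.length_cons] at h4
        have h5 : m < 2 ^ m := Nat.lt_two_pow_self
        omega
      obtain ⟨ρ', h⟩ := runs_sortVertex m a (d.count true) x
        ⟨inp, un, adj, col, row, kk, nn, bad, bitsW m a, [], bitsW m (d.count true - 2),
      [], den, (marks (leftAt m a) 0 d).reverse, (marks (rightAt m a) 0 d).reverse, r, j, []⟩
        o rfl rfl rfl rfl rfl ha hlt
      refine ⟨ρ', h.cast ?_ ?_ rfl⟩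
      · cases x <;> simp [seenVar]
      · cases x <;> simp [marks_append]) none
  have h3 := runs_load (fun v => { v with seen := 0 })
    (seenVar none (row.count true)) ⟨inp, un, adj, col, row, kk, nn, bad, bitsW m a, [],
      bitsW m (row.count true - 2), [], den, (marks (leftAt m a) 0 row).reverse,
      (marks (rightAt m a) 0 row).reverse, [], j, []⟩ o
  refine (h1.seq (h2.seq h3)).mono ?_
  simp only [Stacks.get]
  rw [hrow]
  linarith

/-- Put as many zeros on the empty stack `w` as there are symbols on `un`. -/
def zeros (w : Reg) : Prog := copy .un .i .tmp ;; forEach .i (pushBit w false)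

theorem runs_zeros {w : Reg} (hw : w ≠ .i) (v : Var) (s : Stacks)
    (o : List (Option Bool)) (ht : s.get .tmp = []) (hi : s.get .i = []) (hs : s.get w = []) :
    Runs (zeros w) v s o { v with reg := none }
      (s.set w (List.replicate (s.get .un).length false)) o ((s.get .un).length * 7 + 3) := by
  have h1 := runs_copy_nil (a := .un) (b := .i) (t := .tmp) (by decide) (by decide) (by decide)
    v s o ht hi
  have h2 := runs_forEach (w := .i) (c := pushBit w false) 1 (fun _ => v)
    (fun d r => (s.set w (List.replicate d.length false)).set .i r) (fun _ => o) (s.get .un)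
    (fun _ _ => Stacks.get_set_self _ _ _) (fun d x r _ => ⟨some x, by
      refine (runs_pushBit w false _ _ o).cast rfl ?_ rfl
      rw [Stacks.set_set, Stacks.get_set_of_ne _ hw, Stacks.get_set_self, Stacks.set_comm _ hw,
        Stacks.set_set, List.length_append, List.length_singleton, List.replicate_succ]⟩) none
  have e1 : (s.set w (List.replicate ([] : List Bool).length false)) = s := by
    rw [List.length_nil, List.replicate_zero, ← hs, Stacks.set_get]
  have e2 : (s.set w (List.replicate (s.get .un).length false)).set .i [] =
      s.set w (List.replicate (s.get .un).length false) := by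
    have := Stacks.set_get (s.set w (List.replicate (s.get .un).length false)) .i
    rwa [Stacks.get_set_of_ne _ hw.symm, hi] at this
  rw [e1, e2] at h2
  exact (h1.seq h2).mono (by omega)

/-- List one rectangle. -/
def listRect : Prog :=
  emitSep ;; emitKeep .den .tmp ;; emitSep ;; .emit (fun _ => some true) ;; emitSep ;;
  zeros .rk ;; sortRow ;; emitAll .ww ;; emitSep ;; emitAll .uu ;; clear .rk ;; inc .ida .tmp

/-- The fields are emitted in the opposite order, since the first symbol of an entry must be pushed
last. The sides stand reversed on `uu` and `ww`, and emptying these stacks onto the output restores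
the vertex order. -/
theorem runs_listRect (m a n : ℕ) (ρ : Option Bool) (s : Stacks) (o : List (Option Bool))
    (hi2 : s.ida2 = []) (hr2 : s.rk2 = []) (ht : s.tmp = []) (hi : s.ida = bitsW m a)
    (hr : s.rk = []) (hii : s.i = []) (hu : s.uu = []) (hw : s.ww = []) (ha : a + 1 < 2 ^ m)
    (hrow : s.row.length = m) (hun : s.un.length = m)
    (hden : s.den = ((s.row.count true - 2) * n).bits) :
    Runs listRect (seenVar ρ 0) s o (seenVar none 0) { s with ida := bitsW m (a + 1) }
      (entryWord m n s.row a ++ o) (m * (m * 15 + 42) + s.den.length * 5 + 29) := by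
  obtain ⟨inp, un, adj, col, row, kk, nn, bad, x1, x1', y1, y1', den, uu, ww, i, j, t⟩ := s
  simp only at hi2 hr2 ht hi hr hii hu hw hrow hun hden
  subst hi2 hr2 ht hi hr hii hu hw
  have h1 := (runs_emitSep (seenVar ρ 0)
    ⟨inp, un, adj, col, row, kk, nn, bad, bitsW m a, [], [], [], den, [], [], [], j, []⟩ o).seq
    ((runs_emitKeep (k := .den) (t := .tmp) (by decide) _ _ _ rfl).seq
    ((runs_emitSep _ _ _).seq
    ((Cmd.Exec.emit (fun _ => some true) _ _ _ : Runs (.emit (fun _ => some true)) _ _ _ _ _ _ _).seq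
    ((runs_emitSep _ _ _).seq
    ((runs_zeros (w := .rk) (by decide) _ _ _ rfl rfl rfl).seq
    ((runs_sortRow m a none _ _ rfl rfl rfl rfl
      (by simp [Stacks.set, Stacks.get, hun, bitsW_zero]) rfl rfl rfl (by omega) hrow).seq
    ((runs_emitAll .ww _ _ _).seq
    ((runs_emitSep _ _ _).seq
    ((runs_emitAll .uu _ _ _).seq
    ((runs_clear .rk _ _ _).seq
    (runs_inc (k := .ida) (t := .tmp) (by decide) _ _ _ rfl)))))))))))
  refine (h1.cast rfl ?_ ?_).mono ?_
  · simp [Stacks.set, Stacks.get, incBits_bitsW ha]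
  · simp [Stacks.set, Stacks.get, entryWord, hden]
  · simp only [Stacks.set, Stacks.get, length_bitsW, List.length_reverse, length_marks, hrow, hun]
    linarith

end Prog

/-! ### Counters, denominators and all rectangles of one vertex. -/

namespace Prog

/-- Put a unary counter of the neighbours after the first two on `kk`. -/
def countRow : Prog :=
  copy .row .i .tmp ;;
  forEach .i (.ite (fun v => v.reg.getD false)
    (.ite (fun v => decide (v.seen = 0)) (.load fun v => { v with seen := 1 })
      (.ite (fun v => decide (v.seen = 1)) (.load fun v => { v with seen := 2 })
        (pushBit .kk true)))
    (.load id)) ;;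
  .load fun v => { v with seen := 0 }

theorem runs_countRow (m : ℕ) (ρ : Option Bool) (s : Stacks) (o : List (Option Bool))
    (ht : s.tmp = []) (hi : s.i = []) (hk : s.kk = []) (hrow : s.row.length = m) :
    Runs countRow (seenVar ρ 0) s o (seenVar none 0)
      { s with kk := List.replicate (s.row.count true - 2) true } o (m * 10 + 4) := by
  obtain ⟨inp, un, adj, col, row, kk, nn, bad, x1, x1', y1, y1', den, uu, ww, i, j, t⟩ := s
  simp only at ht hi hk hrow
  subst ht hi hk
  have h1 := runs_copy_nil (a := .row) (b := .i) (t := .tmp) (by decide) (by decide) (by decide)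
    (seenVar ρ 0) ⟨inp, un, adj, col, row, [], nn, bad, x1, x1', y1, y1', den, uu, ww, [], j, []⟩
    o rfl rfl
  have h2 := runs_forEach (w := .i) (c := .ite (fun v => v.reg.getD false)
    (.ite (fun v => decide (v.seen = 0)) (.load fun v => { v with seen := 1 })
      (.ite (fun v => decide (v.seen = 1)) (.load fun v => { v with seen := 2 })
        (pushBit .kk true)))
    (.load id)) 4
    (fun d => seenVar none (d.count true))
    (fun d r => ⟨inp, un, adj, col, row, List.replicate (d.count true - 2) true, nn, bad,
      x1, x1', y1, y1', den, uu, ww, r, j, []⟩)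
    (fun _ => o) row (fun _ _ => rfl) (fun d x r hd => by
      refine ⟨some x, ?_⟩
      cases x with
      | false =>
        refine ((runs_ite_false (fun v : Var => v.reg.getD false) rfl
          (runs_load id _ _ o)).cast ?_ ?_ rfl).mono (by omega)
        · simp [seenVar]
        · simp [Stacks.set]
      | true =>
        rw [List.count_append, List.count_singleton_self]
        generalize d.count true = n
        rcases n with _ | _ | n
        · exact (runs_ite_true (fun v : Var => v.reg.getD false) rfl
            (runs_ite_true (fun v : Var => decide (v.seen = 0)) rfl
            (runs_load (fun v => { v with seen := 1 }) _ _ o))).mono (by omega)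
        · exact (runs_ite_true (fun v : Var => v.reg.getD false) rfl
            (runs_ite_false (fun v : Var => decide (v.seen = 0)) rfl
            (runs_ite_true (fun v : Var => decide (v.seen = 1)) rfl
            (runs_load (fun v => { v with seen := 2 }) _ _ o)))).mono (by omega)
        · refine ((runs_ite_true (fun v : Var => v.reg.getD false) rfl
            (runs_ite_false (fun v : Var => decide (v.seen = 0)) (by simp [seenVar])
            (runs_ite_false (fun v : Var => decide (v.seen = 1)) (by simp [seenVar])
            (runs_pushBit .kk true _ _ o)))).cast ?_ ?_ rfl).mono (by omega)
          · simp [seenVar]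
          · simp [Stacks.set, Stacks.get, List.replicate_succ]) none
  have h3 := runs_load (fun v => { v with seen := 0 })
    (seenVar none (row.count true)) ⟨inp, un, adj, col, row,
      List.replicate (row.count true - 2) true, nn, bad,
      x1, x1', y1, y1', den, uu, ww, [], j, []⟩ o
  refine (h1.seq (h2.seq h3)).mono ?_
  simp only [Stacks.get]
  rw [hrow]
  linarith

/-- Add the length of `w` to the binary number on `den`, emptying `w`. -/
def addLength (w : Reg) : Prog := forEach w (inc .den .tmp)

theorem length_bits_le (n : ℕ) : n.bits.length ≤ n := by
  rw [Nat.size_eq_bits_len]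
  exact Nat.size_le.2 Nat.lt_two_pow_self

/-- Unary becomes binary by repeated increments. The bound `b` on the final value also bounds the
number of digits, crudely but polynomially. -/
theorem runs_addLength {w : Reg} (hw : w ≠ .den) (hw' : w ≠ .tmp) (n b : ℕ) (ρ : Option Bool)
    (s : Stacks) (o : List (Option Bool)) (ht : s.get .tmp = []) (hd : s.get .den = n.bits)
    (hb : n + (s.get w).length ≤ b) :
    Runs (addLength w) (seenVar ρ 0) s o (seenVar none 0)
      ((s.set .den (n + (s.get w).length).bits).set w []) o
      ((s.get w).length * (b * 5 + 9) + 1) := by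
  have h := runs_forEach (w := w) (c := inc .den .tmp) (b * 5 + 8) (fun _ => seenVar none 0)
    (fun d r => (s.set .den (n + d.length).bits).set w r) (fun _ => o) (s.get w)
    (fun _ _ => Stacks.get_set_self _ _ _) (fun d x r hdr => ⟨none, by
      refine ((runs_inc (k := .den) (t := .tmp) (by decide) _ _ o ?_).cast rfl ?_ rfl).mono ?_
      · rw [Stacks.set_set, Stacks.get_set_of_ne _ hw'.symm, Stacks.get_set_of_ne _ (by decide), ht]
      · rw [Stacks.set_set, Stacks.get_set_of_ne _ hw.symm, Stacks.get_set_self, incBits_bits,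
          Stacks.set_comm _ hw.symm, Stacks.set_set, List.length_append, List.length_singleton,
          Nat.add_assoc]
      · rw [Stacks.set_set, Stacks.get_set_of_ne _ hw.symm, Stacks.get_set_self]
        have h1 := length_bits_le (n + d.length)
        have h2 := congrArg List.length hdr
        rw [List.length_append, List.length_cons] at h2
        omega⟩) ρ
  have e : ((s.set .den (n + ([] : List Bool).length).bits).set w (s.get w)) = s := by
    rw [List.length_nil, Nat.add_zero, ← hd, Stacks.set_get, Stacks.set_get]
  rw [e] at h
  exact h

/-- Put the product of the lengths of `kk` and `nn` on `den`. -/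
def denominator : Prog :=
  copy .kk .j .tmp ;; forEach .j (copy .nn .i .tmp ;; addLength .i)

theorem runs_denominator (k n : ℕ) (ρ : Option Bool) (s : Stacks) (o : List (Option Bool))
    (ht : s.tmp = []) (hi : s.i = []) (hj : s.j = []) (hd : s.den = []) (hk : s.kk.length = k)
    (hn : s.nn.length = n) :
    Runs denominator (seenVar ρ 0) s o (seenVar none 0) { s with den := (k * n).bits } o
      (k * (n * (k * n * 5 + 14) + 9) + 3) := by
  obtain ⟨inp, un, adj, col, row, kk, nn, bad, x1, x1', y1, y1', den, uu, ww, i, j, t⟩ := s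
  simp only at ht hi hj hk hd hn
  subst ht hi hj hk hd hn
  have h1 := runs_copy_nil (a := .kk) (b := .j) (t := .tmp) (by decide) (by decide) (by decide)
    (seenVar ρ 0) ⟨inp, un, adj, col, row, kk, nn, bad, x1, x1', y1, y1', [], uu, ww, [], [], []⟩
    o rfl rfl
  have h2 := runs_forEach (w := .j) (c := copy .nn .i .tmp ;; addLength .i)
    (nn.length * (kk.length * nn.length * 5 + 14) + 3) (fun _ => seenVar none 0)
    (fun d r => ⟨inp, un, adj, col, row, kk, nn, bad, x1, x1', y1, y1',
      (d.length * nn.length).bits, uu, ww, [], r, []⟩) (fun _ => o) kk (fun _ _ => rfl)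
    (fun d x r hdr => ⟨none, by
      have hle : d.length * nn.length + nn.length ≤ kk.length * nn.length := by
        have h2 := congrArg List.length hdr
        rw [List.length_append, List.length_cons] at h2
        calc d.length * nn.length + nn.length = (d.length + 1) * nn.length := by ring
          _ ≤ _ := Nat.mul_le_mul_right _ (by omega)
      refine (((runs_copy_nil (a := .nn) (b := .i) (t := .tmp) (by decide) (by decide)
        (by decide) _ _ _ rfl rfl).seq (runs_addLength (w := .i) (by decide) (by decide)
        (d.length * nn.length) (kk.length * nn.length) none _ _ rfl rfl ?_)).cast rfl ?_
          rfl).mono ?_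
      · exact hle
      · simp [Stacks.set, Stacks.get, Nat.add_mul]
      · simp only [Stacks.set, Stacks.get]
        linarith⟩) none
  have e : ([] : List Bool).length * nn.length = 0 := by simp
  rw [e] at h2
  refine (h1.seq (h2.cast rfl rfl rfl)).mono ?_
  simp only [Stacks.get]
  linarith

/-- Push a symbol on `bad` if `kk` is empty. -/
def countBad : Prog :=
  popReg .kk ;; .ite (fun v => v.reg.isSome) (pushReg .kk) (pushBit .bad true)

/-- Emptiness of `kk` is tested by popping a symbol, which is put back if there was one. -/
theorem runs_countBad (k : ℕ) (ρ : Option Bool) (s : Stacks) (o : List (Option Bool))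
    (hk : s.kk = List.replicate k true) :
    ∃ ρ', Runs countBad (seenVar ρ 0) s o (seenVar ρ' 0)
      { s with bad := if k = 0 then true :: s.bad else s.bad } o 3 := by
  obtain ⟨inp, un, adj, col, row, kk, nn, bad, x1, x1', y1, y1', den, uu, ww, i, j, t⟩ := s
  simp only at hk
  subst hk
  have h1 := runs_pop .kk (seenVar ρ 0) ⟨inp, un, adj, col, row, List.replicate k true, nn, bad, x1,
    x1', y1, y1', den, uu, ww, i, j, t⟩ o
  cases k with
  | zero =>
    exact ⟨none, h1.seq (runs_ite_false (fun v : Var => v.reg.isSome) rfl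
      (runs_pushBit .bad true _ _ o))⟩
  | succ k =>
    exact ⟨some true, h1.seq (runs_ite_true (fun v : Var => v.reg.isSome) rfl
      (runs_pushReg .kk _ true _ o rfl))⟩

/-- List all rectangles of the adjacency row. -/
def listRow : Prog :=
  countRow ;; denominator ;; countBad ;; zeros .ida ;; forEach .kk listRect ;; clear .ida ;;
  clear .den

/-- A bound for the running time of `listRow`. -/
def listRowTime (m n : ℕ) : ℕ :=
  m * (m * (m * 15 + 42) + m * n * 5 + 30) + (m * (n * (m * n * 5 + 14) + 9) + 3) + 19 * m +
    m * n * 2 + 13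

theorem runs_listRow (m n : ℕ) (ρ : Option Bool) (s : Stacks) (o : List (Option Bool))
    (hi2 : s.ida2 = []) (hr2 : s.rk2 = []) (ht : s.tmp = []) (hi : s.ida = [])
    (hr : s.rk = []) (hii : s.i = []) (hj : s.j = []) (hk : s.kk = []) (hd : s.den = [])
    (hu : s.uu = []) (hw : s.ww = [])
    (hrow : s.row.length = m) (hun : s.un.length = m) (hn : s.nn.length = n) :
    Runs listRow (seenVar ρ 0) s o (seenVar none 0)
      { s with bad := if s.row.count true - 2 = 0 then true :: s.bad else s.bad }
      (rowWord m n s.row ++ o) (listRowTime m n) := by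
  obtain ⟨inp, un, adj, col, row, kk, nn, bad, x1, x1', y1, y1', den, uu, ww, i, j, t⟩ := s
  simp only at hi2 hr2 ht hi hr hii hj hk hd hu hw hrow hun hn
  subst hi2 hr2 ht hi hr hii hj hk hd hu hw hn
  have hle : row.count true - 2 ≤ m :=
    (Nat.sub_le _ _).trans (List.count_le_length.trans hrow.le)
  have h1 := runs_countRow m ρ
    ⟨inp, un, adj, col, row, [], nn, bad, [], [], [], [], [], [], [], [], [], []⟩ o rfl rfl rfl hrow
  generalize hK : row.count true - 2 = K at *
  have h2 := runs_denominator K nn.length none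
    ⟨inp, un, adj, col, row, List.replicate K true, nn, bad, [], [], [], [], [], [], [], [], [], []⟩
    o rfl rfl rfl rfl (by simp) rfl
  obtain ⟨ρ', h3⟩ := runs_countBad K none
    ⟨inp, un, adj, col, row, List.replicate K true, nn, bad, [], [], [], [],
      (K * nn.length).bits, [], [], [], [], []⟩ o rfl
  have h4 := runs_zeros (w := .ida) (by decide) (seenVar ρ' 0)
    ⟨inp, un, adj, col, row, List.replicate K true, nn, if K = 0 then true :: bad else bad,
      [], [], [], [], (K * nn.length).bits, [], [], [], [], []⟩ o rfl rfl rfl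
  generalize (if K = 0 then true :: bad else bad) = bad' at *
  have hbits : (K * nn.length).bits.length ≤ m * nn.length :=
    (length_bits_le _).trans (Nat.mul_le_mul_right _ hle)
  -- The unary counter `kk` is regarded as the image of `List.range K`, and the index of the current
  -- rectangle is the number of rounds done. The entries come out with decreasing index because the
  -- output is a stack.
  have h5 := runs_forEach_map (w := .kk) (c := listRect) (fun _ : ℕ => true)
    (m * (m * 15 + 42) + m * nn.length * 5 + 29) (fun _ => seenVar none 0)
    (fun d r => ⟨inp, un, adj, col, row, r.map fun _ => true, nn, bad', bitsW m d.length, [], [],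
      [], (K * nn.length).bits, [], [], [], [], []⟩)
    (fun d => (List.range d.length).reverse.flatMap (entryWord m nn.length row) ++ o)
    (List.range K) (fun _ _ => rfl) (fun d x r hdr => ⟨none, by
      have hlt : d.length + 1 < 2 ^ m := by
        have h2 := congrArg List.length hdr
        rw [List.length_append, List.length_cons, List.length_range] at h2
        have h5 : m < 2 ^ m := Nat.lt_two_pow_self
        omega
      refine ((runs_listRect m d.length nn.length (some true) _ _ rfl rfl rfl rfl rfl rfl rfl rfl
        hlt hrow hun ?_).cast rfl ?_ ?_).mono ?_
      · rw [← hK]; rfl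
      · simp [Stacks.set]
      · simp only [List.length_append, List.length_singleton, List.range_succ, List.reverse_append,
          List.reverse_singleton, List.flatMap_append, List.flatMap_singleton, List.append_assoc]
        rfl
      · simp only [Stacks.set]
        omega⟩) none
  have h6 := runs_clear .ida (seenVar none 0) ⟨inp, un, adj, col, row, [], nn, bad',
    bitsW m (List.range K).length, [], [], [], (K * nn.length).bits, [], [], [], [], []⟩
    ((List.range (List.range K).length).reverse.flatMap (entryWord m nn.length row) ++ o)
  have h7 := runs_clear .den (seenVar none 0) ⟨inp, un, adj, col, row, [], nn, bad',
    [], [], [], [], (K * nn.length).bits, [], [], [], [], []⟩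
    ((List.range (List.range K).length).reverse.flatMap (entryWord m nn.length row) ++ o)
  have e : Stacks.mk inp un adj col row ((List.range K).map fun _ => true) nn bad'
      (bitsW m ([] : List ℕ).length) [] [] [] (K * nn.length).bits [] [] [] [] [] =
      (⟨inp, un, adj, col, row, List.replicate K true, nn, bad', List.replicate un.length false,
        [], [], [], (K * nn.length).bits, [], [], [], [], []⟩ : Stacks) := by
    rw [List.map_const', List.length_range, hun, List.length_nil, bitsW_zero]
  rw [e] at h5
  refine ((h1.seq (h2.seq (h3.seq (h4.seq (h5.seq (h6.seq h7)))))).cast rfl rfl ?_).mono ?_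
  · rw [rowWord, hK, List.length_range]
  · simp only [Stacks.get, hun, List.length_range, length_bitsW]
    have i1 : K * (m * (m * 15 + 42) + m * nn.length * 5 + 29 + 1) ≤
        m * (m * (m * 15 + 42) + m * nn.length * 5 + 30) := Nat.mul_le_mul_right _ hle
    have i2 : K * (nn.length * (K * nn.length * 5 + 14) + 9) ≤
        m * (nn.length * (m * nn.length * 5 + 14) + 9) := by gcongr
    rw [listRowTime]
    omega

end Prog

/-! ### Reading the input and running through all vertices. -/

namespace Prog

/-- Move as many symbols as there are on `un` from `x` to `y`, reversing them. -/
def transfer (x y : Reg) : Prog := copy .un .i .tmp ;; forEach .i (popReg x ;; pushReg y)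

/-- The rows of the matrix follow each other without separators, so the length of a row is counted
off on `un`. -/
theorem runs_transfer {x y : Reg} (hxy : x ≠ y) (hxi : x ≠ .i) (hyi : y ≠ .i) (v : Var)
    (s : Stacks) (o : List (Option Bool)) (l l' : List Bool) (ht : s.get .tmp = [])
    (hi : s.get .i = []) (hx : s.get x = l ++ l') (hl : l.length = (s.get .un).length) :
    Runs (transfer x y) v s o { v with reg := none }
      ((s.set x l').set y (l.reverse ++ s.get y)) o ((s.get .un).length * 8 + 3) := by
  have h1 := runs_copy_nil (a := .un) (b := .i) (t := .tmp) (by decide) (by decide) (by decide)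
    v s o ht hi
  have h2 := runs_forEach_map (w := .i) (c := popReg x ;; pushReg y) (Prod.fst : Bool × Bool → Bool)
    2 (fun _ => v)
    (fun d r => ((s.set x (r.map Prod.snd ++ l')).set y ((d.map Prod.snd).reverse ++ s.get y)).set
      .i (r.map Prod.fst)) (fun _ => o) ((s.get .un).zip l)
    (fun _ _ => Stacks.get_set_self _ _ _) (fun d p r _ => ⟨some p.2, by
      rw [Stacks.set_set]
      refine ((runs_popReg x _ p.2 (r.map Prod.snd ++ l') _ o ?_).seq
        (runs_pushReg y _ p.2 _ o rfl)).cast rfl ?_ rfl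
      · rw [Stacks.get_set_of_ne _ hxi, Stacks.get_set_of_ne _ hxy, Stacks.get_set_self]
        rfl
      · rw [Stacks.get_set_of_ne _ hxy.symm, Stacks.get_set_of_ne _ hyi, Stacks.get_set_self,
          Stacks.set_comm _ hxi, Stacks.set_comm _ hxy, Stacks.set_set, Stacks.set_comm _ hyi,
          Stacks.set_set]
        simp⟩) none
  rw [List.map_fst_zip hl.ge, List.map_snd_zip hl.le, ← hx, Stacks.set_get] at h2
  have e1 : (s.set y ((([] : List (Bool × Bool)).map Prod.snd).reverse ++ s.get y)) = s :=
    Stacks.set_get s y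
  have e2 : (((s.set x ((([] : List (Bool × Bool)).map Prod.snd) ++ l')).set y
      (l.reverse ++ s.get y)).set .i (([] : List (Bool × Bool)).map Prod.fst)) =
      (s.set x l').set y (l.reverse ++ s.get y) := by
    have := Stacks.set_get ((s.set x l').set y (l.reverse ++ s.get y)) .i
    rwa [Stacks.get_set_of_ne _ hyi.symm, Stacks.get_set_of_ne _ hxi.symm, hi] at this
  rw [e1, e2] at h2
  refine (h1.seq h2).mono ?_
  rw [List.length_zip, hl, min_self]
  omega

/-- List all rectangles of one vertex, whose colour has just been read. -/
def listVertex (b : Bool) : Prog :=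
  .ite (fun v => v.reg == some b) (transfer .adj .row ;; listRow ;; clear .row)
    (transfer .adj .row ;; clear .row)

/-- List all rectangles of all vertices. -/
def listVertices (b : Bool) : Prog := forEach .col (listVertex b)

/-- `L` is in the order of treatment, each row lying reversed on `adj`; the transfer to `row` turns
it round. The counter `bad` grows with each vertex of colour `b` that has no rectangle. -/
theorem runs_listVertices (b : Bool) (m n : ℕ) (ρ : Option Bool) (s : Stacks)
    (o : List (Option Bool)) (L : List (Bool × List Bool)) (k : ℕ)
    (hi2 : s.ida2 = []) (hr2 : s.rk2 = []) (ht : s.tmp = []) (hi : s.ida = [])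
    (hr : s.rk = []) (hii : s.i = []) (hj : s.j = []) (hk : s.kk = []) (hd : s.den = [])
    (hu : s.uu = []) (hw : s.ww = []) (hrow : s.row = [])
    (hun : s.un.length = m) (hn : s.nn.length = n) (hadj : s.adj = L.flatMap fun p => p.2.reverse)
    (hcol : s.col = L.map Prod.fst) (hL : ∀ p ∈ L, p.2.length = m)
    (hbad : s.bad = List.replicate k true) :
    Runs (listVertices b) (seenVar ρ 0) s o (seenVar none 0)
      { s with
        adj := []
        col := []
        bad := List.replicate
          (k + L.countP fun p => p.1 == b && decide (p.2.count true - 2 = 0)) true }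
      (L.reverse.flatMap (fun p => if p.1 == b then rowWord m n p.2 else []) ++ o)
      (L.length * (listRowTime m n + m * 10 + 6) + 1) := by
  obtain ⟨inp, un, adj, col, row, kk, nn, bad, x1, x1', y1, y1', den, uu, ww, i, j, t⟩ := s
  simp only at hi2 hr2 ht hi hr hii hj hk hd hu hw hrow hun hn hadj hcol hbad
  subst hi2 hr2 ht hi hr hii hj hk hd hu hw hn hrow hadj hcol hbad
  have h := runs_forEach_map (w := .col) (c := listVertex b) (Prod.fst : Bool × List Bool → Bool)
    (listRowTime m nn.length + m * 10 + 5) (fun _ => seenVar none 0)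
    (fun d r => ⟨inp, un, r.flatMap fun p => p.2.reverse, r.map Prod.fst, [], [], nn,
      List.replicate (k + d.countP fun p => p.1 == b && decide (p.2.count true - 2 = 0)) true,
      [], [], [], [], [], [], [], [], [], []⟩)
    (fun d => d.reverse.flatMap (fun p => if p.1 == b then rowWord m nn.length p.2 else []) ++ o)
    L (fun _ _ => rfl) (fun d p r hdr => ⟨none, by
      have hp : p.2.length = m := hL p (by simp [hdr])
      have h1 := runs_transfer (x := .adj) (y := .row) (by decide) (by decide) (by decide)
        (seenVar (some p.1) 0)
        ⟨inp, un, (p :: r).flatMap fun p => p.2.reverse, r.map Prod.fst, [], [], nn,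
          List.replicate (k + d.countP fun p => p.1 == b && decide (p.2.count true - 2 = 0)) true,
          [], [], [], [], [], [], [], [], [], []⟩
        (d.reverse.flatMap (fun p => if p.1 == b then rowWord m nn.length p.2 else []) ++ o)
        p.2.reverse (r.flatMap fun p => p.2.reverse) rfl rfl rfl
        (by rw [List.length_reverse, hp]; exact hun.symm)
      cases hb : p.1 == b with
      | false =>
        have hb' : p.1 ≠ b := by simpa using hb
        refine ((runs_ite_false (fun v : Var => v.reg == some b) ?_
          (h1.seq (runs_clear .row _ _ _))).cast rfl ?_ ?_).mono ?_
        · simpa [seenVar] using hb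
        · simp [Stacks.set, List.countP_append, hb]
        · simp [hb']
        · simp only [Stacks.set, Stacks.get, hun, List.length_append, List.length_reverse, hp,
            List.length_nil]
          omega
      | true =>
        have hb' : p.1 = b := by simpa using hb
        refine ((runs_ite_true (fun v : Var => v.reg == some b) ?_
          (h1.seq ((runs_listRow m nn.length none _ _ rfl rfl rfl rfl rfl rfl rfl rfl rfl rfl rfl
            ?_ hun rfl).seq (runs_clear .row _ _ _)))).cast rfl ?_ ?_).mono ?_
        · simpa [seenVar] using hb
        · simp [Stacks.set, Stacks.get, hp]
        · by_cases h0 : p.2.count true - 2 = 0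
          · simp [Stacks.set, Stacks.get, List.countP_append, hb, h0,
              List.replicate_succ, ← Nat.add_assoc]
          · simp [Stacks.set, Stacks.get, List.countP_append, hb, h0]
        · simp [Stacks.set, Stacks.get, hb']
        · simp only [Stacks.set, Stacks.get, hun, List.length_append, List.length_reverse, hp,
            List.length_nil]
          omega⟩) ρ
  exact h.cast rfl rfl rfl

/-- List the empty rectangle, with the numerator on `bad` and the denominator on `nn` in unary. -/
def listEmpty : Prog :=
  emitSep ;; addLength .nn ;; emitKeep .den .tmp ;; clear .den ;; emitSep ;;
  addLength .bad ;; emitKeep .den .tmp ;; clear .den ;; emitSep ;;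
  zeros .rk ;; emitAll .rk ;; emitSep ;; zeros .rk ;; emitAll .rk ;; clear .un

/-- The output word of the empty rectangle. -/
def emptyWord (m k n : ℕ) : List (Option Bool) :=
  List.replicate m (some false) ++ none :: (List.replicate m (some false) ++ none ::
    (k.bits.map some ++ none :: (n.bits.map some ++ [none])))

/-- The counters `nn` and `bad` become the denominator and the numerator, and both sides are zero
words. All stacks still in use are emptied, as halting requires. -/
theorem runs_listEmpty (m k n : ℕ) (ρ : Option Bool) (s : Stacks) (o : List (Option Bool))
    (ht : s.tmp = []) (hr : s.rk = []) (hii : s.i = []) (hd : s.den = [])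
    (hun : s.un.length = m) (hn : s.nn.length = n) (hk : s.bad.length = k) :
    Runs listEmpty (seenVar ρ 0) s o (seenVar none 0) { s with un := [], nn := [], bad := [] }
      (emptyWord m k n ++ o) (n * (n * 5 + 16) + k * (k * 5 + 16) + m * 20 + 22) := by
  obtain ⟨inp, un, adj, col, row, kk, nn, bad, x1, x1', y1, y1', den, uu, ww, i, j, t⟩ := s
  simp only at ht hr hii hd hun hn hk
  subst ht hr hii hd hn hk
  have h1 := (runs_emitSep (seenVar ρ 0)
    ⟨inp, un, adj, col, row, kk, nn, bad, x1, x1', [], y1', [], uu, ww, [], j, []⟩ o).seq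
    ((runs_addLength (w := .nn) (by decide) (by decide) 0 nn.length ρ _ _ rfl rfl
      (by simp [Stacks.get])).seq
    ((runs_emitKeep (k := .den) (t := .tmp) (by decide) _ _ _ rfl).seq
    ((runs_clear .den _ _ _).seq
    ((runs_emitSep _ _ _).seq
    ((runs_addLength (w := .bad) (by decide) (by decide) 0 bad.length none _ _ rfl rfl
      (by simp [Stacks.get, Stacks.set])).seq
    ((runs_emitKeep (k := .den) (t := .tmp) (by decide) _ _ _ rfl).seq
    ((runs_clear .den _ _ _).seq
    ((runs_emitSep _ _ _).seq
    ((runs_zeros (w := .rk) (by decide) _ _ _ rfl rfl rfl).seq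
    ((runs_emitAll .rk _ _ _).seq
    ((runs_emitSep _ _ _).seq
    ((runs_zeros (w := .rk) (by decide) _ _ _ rfl rfl rfl).seq
    ((runs_emitAll .rk _ _ _).seq
    (runs_clear .un _ _ _))))))))))))))
  refine (h1.cast rfl ?_ ?_).mono ?_
  · simp [Stacks.set]
  · simp [Stacks.set, Stacks.get, emptyWord, hun]
  · have b1 := length_bits_le nn.length
    have b2 := length_bits_le bad.length
    simp only [Stacks.set, Stacks.get, hun, List.length_replicate, Nat.zero_add]
    linarith

/-- Read a unary number, up to the first `false`. -/
def readUnary : Prog :=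
  .loop .inp (fun v a => { v with reg := a }) (fun v => v.reg == some true) (pushBit .un true)

theorem runs_readUnary (k : ℕ) (v : Var) (s : Stacks) (o : List (Option Bool)) (l : List Bool)
    (hs : s.inp = List.replicate k true ++ false :: l) :
    Runs readUnary v s o { v with reg := some false }
      { s with inp := l, un := List.replicate k true ++ s.un } o (k * 2 + 1) := by
  induction k generalizing v s with
  | zero =>
    have h := Cmd.Exec.loop_exit (w := .inp) (f := fun (v : Var) a => { v with reg := a })
      (p := fun v => v.reg == some true) (body := pushBit .un true) (v := v) (S := s.get) (o := o)
    have e : s.get .inp = false :: l := hs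
    rw [e, Stacks.update_get] at h
    exact h rfl
  | succ k ih =>
    have e : s.get .inp = true :: (List.replicate k true ++ false :: l) := hs
    have h := Cmd.Exec.loop_step (w := .inp) (f := fun (v : Var) a => { v with reg := a })
      (p := fun v => v.reg == some true) (body := pushBit .un true) (v := v) (S := s.get) (o := o)
      (t := 1) (t' := k * 2 + 1) (s'' := ⟨{ v with reg := some false },
        Stacks.get { s with inp := l, un := List.replicate (k + 1) true ++ s.un }, o⟩)
      (s' := ⟨{ v with reg := some true },
        Stacks.get { s with inp := List.replicate k true ++ false :: l, un := true :: s.un }, o⟩)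
    rw [e, Stacks.update_get] at h
    refine Cmd.Exec.mono (h rfl (runs_pushBit .un true _ _ o) ?_) (by omega)
    refine (ih { v with reg := some true }
      { s with inp := List.replicate k true ++ false :: l, un := true :: s.un } rfl).cast rfl ?_ rfl
    simp only [List.replicate_succ', List.append_assoc, List.singleton_append]

/-- Read the adjacency matrix. -/
def readMatrix : Prog := copy .un .j .tmp ;; forEach .j (transfer .inp .adj)

/-- Row by row, everything lands reversed on `adj`, so the last vertex is on top, in step with the
reversed colours on `col`. -/
theorem runs_readMatrix (m : ℕ) (ρ : Option Bool) (s : Stacks) (o : List (Option Bool))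
    (rows : List (List Bool)) (l : List Bool) (ht : s.tmp = []) (hi : s.i = []) (hj : s.j = [])
    (ha : s.adj = []) (hun : s.un.length = m) (hrows : rows.length = m)
    (hlen : ∀ r ∈ rows, r.length = m) (hinp : s.inp = rows.flatten ++ l) :
    Runs readMatrix (seenVar ρ 0) s o (seenVar none 0)
      { s with inp := l, adj := rows.flatten.reverse } o (m * (m * 8 + 9) + 3) := by
  obtain ⟨inp, un, adj, col, row, kk, nn, bad, x1, x1', y1, y1', den, uu, ww, i, j, t⟩ := s
  simp only at ht hi hj ha hun hinp
  subst ht hi hj ha hinp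
  have h1 := runs_copy_nil (a := .un) (b := .j) (t := .tmp) (by decide) (by decide) (by decide)
    (seenVar ρ 0) ⟨rows.flatten ++ l, un, [], col, row, kk, nn, bad, x1, x1', y1, y1', den, uu, ww,
      [], [], []⟩ o rfl rfl
  have h2 := runs_forEach_map (w := .j) (c := transfer .inp .adj)
    (Prod.fst : Bool × List Bool → Bool) (m * 8 + 3) (fun _ => seenVar none 0)
    (fun d r => ⟨(r.map Prod.snd).flatten ++ l, un, (d.map Prod.snd).flatten.reverse, col, row, kk,
      nn, bad, x1, x1', y1, y1', den, uu, ww, [], r.map Prod.fst, []⟩) (fun _ => o) (un.zip rows)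
    (fun _ _ => rfl) (fun d p r hdr => ⟨none, by
      have hp : p.2.length = m := by
        refine hlen _ (List.of_mem_zip (a := p.1) (l₁ := un) ?_).2
        rw [hdr]
        simp
      refine ((runs_transfer (x := .inp) (y := .adj) (by decide) (by decide) (by decide) _ _ o
        p.2 ((r.map Prod.snd).flatten ++ l) rfl rfl ?_ ?_).cast rfl ?_ rfl).mono ?_
      · simp [Stacks.set, Stacks.get]
      · simp [Stacks.set, Stacks.get, hp, hun]
      · simp [Stacks.set, Stacks.get]
      · simp [Stacks.set, Stacks.get, hun]⟩) none
  rw [List.map_fst_zip (hun.trans hrows.symm).le, List.map_snd_zip (hun.trans hrows.symm).ge] at h2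
  refine (h1.seq h2).mono ?_
  rw [List.length_zip, hun, hrows, min_self]
  simp only [Stacks.get, hun]
  linarith

/-- Put a unary counter of the vertices of colour `b` on `nn`. -/
def countColour (b : Bool) : Prog :=
  copy .col .i .tmp ;;
  forEach .i (.ite (fun v => v.reg == some b) (pushBit .nn true) (.load id))

theorem runs_countColour (b : Bool) (m k : ℕ) (ρ : Option Bool) (s : Stacks)
    (o : List (Option Bool)) (ht : s.tmp = []) (hi : s.i = []) (hc : s.col.length = m)
    (hn : s.nn = List.replicate k true) :
    Runs (countColour b) (seenVar ρ 0) s o (seenVar none 0)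
      { s with nn := List.replicate (k + s.col.count b) true } o (m * 8 + 3) := by
  obtain ⟨inp, un, adj, col, row, kk, nn, bad, x1, x1', y1, y1', den, uu, ww, i, j, t⟩ := s
  simp only at ht hi hc hn
  subst ht hi hn
  have h1 := runs_copy_nil (a := .col) (b := .i) (t := .tmp) (by decide) (by decide) (by decide)
    (seenVar ρ 0) ⟨inp, un, adj, col, row, kk, List.replicate k true, bad, x1, x1', y1, y1', den,
      uu, ww, [], j, []⟩ o rfl rfl
  have h2 := runs_forEach (w := .i)
    (c := .ite (fun v => v.reg == some b) (pushBit .nn true) (.load id)) 2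
    (fun _ => seenVar none 0)
    (fun d r => ⟨inp, un, adj, col, row, kk, List.replicate (k + d.count b) true, bad,
      x1, x1', y1, y1', den, uu, ww, r, j, []⟩)
    (fun _ => o) col (fun _ _ => rfl) (fun d x r hd => ⟨some x, by
      cases hx : x == b with
      | false =>
        refine (runs_ite_false (t := 1) (fun v : Var => v.reg == some b) ?_
          (runs_load id _ _ o)).cast rfl ?_ rfl
        · simpa using hx
        · simp [Stacks.set, List.count_append, List.count_singleton, hx]
      | true =>
        refine (runs_ite_true (t := 1) (fun v : Var => v.reg == some b) ?_
          (runs_pushBit .nn true _ _ o)).cast rfl ?_ rfl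
        · simpa using hx
        · simp [Stacks.set, Stacks.get, List.count_append, List.count_singleton, hx,
            List.replicate_succ, ← Nat.add_assoc]⟩) none
  refine (h1.seq h2).mono ?_
  simp only [Stacks.get, hc]
  omega

/-- The listing program. -/
def listing (b : Bool) : Prog :=
  readUnary ;; readMatrix ;; move .inp .col ;; pushBit .nn true ;; countColour b ;;
  pushBit .bad true ;; listVertices b ;; listEmpty

/-- A bound for the running time of `listing`. -/
def listingTime (m n : ℕ) : ℕ :=
  (m * (listRowTime m n + m * 10 + 6) + 1) + 2 * (n * (n * 5 + 16)) + m * (m * 8 + 51) + 50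

/-- The output word of the listing program. -/
def listingWord (b : Bool) (m n : ℕ) (L : List (Bool × List Bool)) : List (Option Bool) :=
  emptyWord m (1 + L.countP fun p => p.1 == b && decide (p.2.count true - 2 = 0)) n ++
    L.flatMap fun p => if p.1 == b then rowWord m n p.2 else []

/-- The counters `nn` and `bad` both start at one, for the phantom element. Vertices are treated
from the last to the first, the empty rectangle at the end, and the output stack then shows them in
the intended order. -/
theorem runs_listing (b : Bool) (L : List (Bool × List Bool))
    (hL : ∀ p ∈ L, p.2.length = L.length) :
    Runs (listing b) (seenVar none 0)
      { inp := List.replicate L.length true ++ false ::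
          ((L.map Prod.snd).flatten ++ L.map Prod.fst) } []
      (seenVar none 0) {} (listingWord b L.length (1 + (L.map Prod.fst).count b) L)
      (listingTime L.length (1 + (L.map Prod.fst).count b)) := by
  generalize hm : L.length = m at *
  generalize hN : (L.map Prod.fst).count b = N
  have h1 := runs_readUnary m (seenVar none 0) { inp := List.replicate m true ++ false ::
    ((L.map Prod.snd).flatten ++ L.map Prod.fst) } [] _ rfl
  have h2 := runs_readMatrix m (some false)
    { inp := (L.map Prod.snd).flatten ++ L.map Prod.fst, un := List.replicate m true } [] (L.map Prod.snd) (L.map Prod.fst) rfl rfl rfl rfl (by simp)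
    (by simp [hm]) (fun r hr => by
      obtain ⟨p, hp, rfl⟩ := List.mem_map.1 hr
      exact hL p hp) rfl
  have h3 := runs_move (a := .inp) (b := .col) (by decide) (seenVar none 0)
    { inp := L.map Prod.fst, adj := (L.map Prod.snd).flatten.reverse,
      un := List.replicate m true } []
  have h4 := runs_pushBit .nn true (seenVar none 0)
    { col := (L.map Prod.fst).reverse ++ [], adj := (L.map Prod.snd).flatten.reverse,
      un := List.replicate m true } []
  have h5 := runs_countColour b m 1 none
    { col := (L.map Prod.fst).reverse ++ [], adj := (L.map Prod.snd).flatten.reverse,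
      un := List.replicate m true, nn := [true] } [] rfl rfl (by simp [hm]) rfl
  have h6 := runs_pushBit .bad true (seenVar none 0)
    { col := (L.map Prod.fst).reverse ++ [], adj := (L.map Prod.snd).flatten.reverse,
      un := List.replicate m true,
      nn := List.replicate (1 + ((L.map Prod.fst).reverse ++ []).count b) true } []
  have h7 := runs_listVertices b m (1 + N) none
    { col := (L.map Prod.fst).reverse ++ [], adj := (L.map Prod.snd).flatten.reverse,
      un := List.replicate m true,
      nn := List.replicate (1 + ((L.map Prod.fst).reverse ++ []).count b) true,
      bad := [true] } [] L.reverse 1 rfl rfl rfl rfl rfl rfl rfl rfl rfl rfl rfl rfl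
    (by simp) (by simp [hN])
    (by simp [List.reverse_flatten, List.flatMap, List.map_reverse, Function.comp_def])
    (by simp) (fun p hp => hL p (List.mem_reverse.1 hp)) rfl
  have h8 := runs_listEmpty m
    (1 + L.reverse.countP fun p => p.1 == b && decide (p.2.count true - 2 = 0)) (1 + N) none
    { un := List.replicate m true,
      nn := List.replicate (1 + ((L.map Prod.fst).reverse ++ []).count b) true,
      bad := List.replicate
        (1 + L.reverse.countP fun p => p.1 == b && decide (p.2.count true - 2 = 0)) true }
    (L.reverse.reverse.flatMap (fun p => if p.1 == b then rowWord m (1 + N) p.2 else []) ++ [])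
    rfl rfl rfl rfl (by simp) (by simp [hN]) (by simp)
  refine (((h1.cast (s'' := _) rfl (by rw [List.append_nil]) rfl).seq (h2.seq (h3.seq (h4.seq (h5.seq (h6.seq (h7.seq h8))))))).cast rfl rfl ?_).mono ?_
  · simp [listingWord]
  · have hle : (L.countP fun p => p.1 == b && decide (p.2.count true - 2 = 0)) ≤ N := by
      rw [← hN, List.count_eq_countP, List.countP_map]
      refine List.countP_mono_left fun p _ hp => ?_
      simp only [Bool.and_eq_true] at hp
      exact hp.1
    simp only [Stacks.get, List.length_map, List.length_reverse, List.countP_reverse, hm]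
    generalize (L.countP fun p => p.1 == b && decide (p.2.count true - 2 = 0)) = k at *
    have i1 : (1 + k) * ((1 + k) * 5 + 16) ≤ (1 + N) * ((1 + N) * 5 + 16) := by gcongr
    rw [listingTime]
    linarith

end Prog

/-! ### The list of rectangles -/

theorem getElem_marks (f : ℕ → Bool) (s : ℕ) (l : List Bool) (i : ℕ) (hi : i < l.length) :
    (marks f s l)[i]'(by rwa [length_marks]) = (l[i] && f (s + (l.take i).count true)) := by
  induction l generalizing s i with
  | nil => simp at hi
  | cons b l ih =>
    cases i with
    | zero => simp [marks]
    | succ i =>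
      simp only [marks, List.getElem_cons_succ, List.take_succ_cons]
      rw [ih _ _ (by simpa using hi)]
      cases b <;> simp [Nat.add_assoc, Nat.add_comm 1]

/-- Identifies the counter that the program keeps while scanning a row with the number of earlier
neighbours. -/
theorem count_take_map_finRange {m : ℕ} (p : Fin m → Bool) (v : Fin m) :
    (((List.finRange m).map p).take v).count true =
      (Finset.univ.filter fun u => p u = true ∧ u < v).card := by
  have h : ∀ i ≤ m, (((List.finRange m).map p).take i).count true =
      (Finset.univ.filter fun u : Fin m => p u = true ∧ (u : ℕ) < i).card := by
    intro i
    induction i with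
    | zero => simp
    | succ i ih =>
      intro hi
      have hl : i < ((List.finRange m).map p).length := by simpa using hi
      rw [List.take_succ_eq_append_getElem hl, List.count_append, ih (by omega)]
      have e : (Finset.univ.filter fun u : Fin m => p u = true ∧ (u : ℕ) < i + 1) =
          (Finset.univ.filter fun u : Fin m => p u = true ∧ (u : ℕ) < i) ∪
          (Finset.univ.filter fun u : Fin m => p u = true ∧ u = ⟨i, hi⟩) := by
        ext u
        simp only [Finset.mem_filter, Finset.mem_univ, true_and, Finset.mem_union, Fin.ext_iff]
        constructor
        · rintro ⟨h1, h2⟩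
          rcases Nat.lt_succ_iff_lt_or_eq.1 h2 with h | h
          · exact Or.inl ⟨h1, h⟩
          · exact Or.inr ⟨h1, h⟩
        · rintro (⟨h1, h2⟩ | ⟨h1, h2⟩) <;> exact ⟨h1, by omega⟩
      rw [e, Finset.card_union_of_disjoint]
      · congr 1
        by_cases hp : p ⟨i, hi⟩ = true
        · have e2 : (Finset.univ.filter fun u : Fin m => p u = true ∧ u = ⟨i, hi⟩) = {⟨i, hi⟩} := by
            ext u
            simp only [Finset.mem_filter, Finset.mem_univ, true_and, Finset.mem_singleton]
            exact ⟨fun h => h.2, fun h => ⟨h ▸ hp, h⟩⟩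
          rw [e2]
          simp [hp]
        · have e2 : (Finset.univ.filter fun u : Fin m => p u = true ∧ u = ⟨i, hi⟩) = ∅ := by
            ext u
            simp only [Finset.mem_filter, Finset.mem_univ, true_and, Finset.notMem_empty, iff_false]
            rintro ⟨h1, rfl⟩
            exact hp h1
          rw [e2]
          simp [hp]
      · rw [Finset.disjoint_left]
        intro u h1 h2
        simp only [Finset.mem_filter, Finset.mem_univ, true_and] at h1 h2
        rw [h2.2] at h1
        exact absurd h1.2 (lt_irrefl _)
  exact h v v.2.le

theorem marks_map_finRange {m : ℕ} (f : ℕ → Bool) (p : Fin m → Bool) :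
    marks f 0 ((List.finRange m).map p) = (List.finRange m).map fun v =>
      p v && f (Finset.univ.filter fun u => p u = true ∧ u < v).card := by
  apply List.ext_getElem
  · simp [length_marks]
  · intro i h1 h2
    have hi : i < m := by simpa using h2
    rw [getElem_marks _ _ _ _ (by simpa using hi)]
    have := count_take_map_finRange p ⟨i, hi⟩
    simp only at this
    simp [this]

theorem count_map_finRange {m : ℕ} (p : Fin m → Bool) (b : Bool) :
    ((List.finRange m).map p).count b = (Finset.univ.filter fun u => p u = b).card := by
  rw [List.count_eq_countP, List.countP_map, List.countP_eq_length_filter]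
  rw [Finset.card_def, Finset.filter_val]
  have : (Finset.univ : Finset (Fin m)).val = (List.finRange m : Multiset (Fin m)) := rfl
  rw [this, Multiset.filter_coe, Multiset.coe_card]
  congr 2

/-! ### The rectangles as finite sets, and agreement with the output of the program. -/

namespace Multigraph

variable {m : ℕ} (G : Multigraph (Fin m)) (c : Fin m → Bool) (b : Bool)

/-- The number of neighbours of `w` before `v`. -/
def pos (w v : Fin m) : ℕ := ((G.nbr w).filter (· < v)).card

/-- The number of rectangles of `w`. -/
def numRect (w : Fin m) : ℕ := (G.nbr w).card - 2

/-- The left side of the rectangle number `a` of `w`. -/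
def leftSet (w : Fin m) (a : ℕ) : Finset (Fin m) :=
  (G.nbr w).filter fun v => leftAt m a (G.pos w v) = true

/-- The right side of the rectangle number `a` of `w`. -/
def rightSet (w : Fin m) (a : ℕ) : Finset (Fin m) :=
  (G.nbr w).filter fun v => rightAt m a (G.pos w v) = true

/-- The vertices of colour `b`. -/
def colourClass (c : Fin m → Bool) (b : Bool) : Finset (Fin m) := Finset.univ.filter (c · = b)

/-- The vertices of colour `b` without rectangles. -/
def sparse : Finset (Fin m) := (colourClass c b).filter (G.numRect · = 0)

/-- The entry of the rectangle number `a` of `w`. -/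
def entry (w : Fin m) (a : ℕ) : ListEntry m :=
  ⟨G.leftSet w a, G.rightSet w a, 1, G.numRect w * (1 + (colourClass c b).card)⟩

/-- The entry of the empty rectangle. -/
def emptyEntry : ListEntry m := ⟨∅, ∅, 1 + (G.sparse c b).card, 1 + (colourClass c b).card⟩

/-- The list of all rectangles with their probabilities. -/
def entries : List (ListEntry m) :=
  G.emptyEntry c b :: (List.finRange m).flatMap fun w =>
    if c w == b then (List.range (G.numRect w)).reverse.map (G.entry c b w) else []

/-- The adjacency row of a vertex. -/
def row (w : Fin m) : List Bool := (List.finRange m).map fun v => decide (v ∈ G.nbr w)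

theorem count_row (w : Fin m) : (G.row w).count true = (G.nbr w).card := by
  rw [row, count_map_finRange]
  congr 1
  ext u
  simp

theorem marks_row (f : ℕ → Bool) (w : Fin m) :
    (marks f 0 (G.row w)).map some =
      encodeSet ((G.nbr w).filter fun v => f (G.pos w v) = true) := by
  rw [row, marks_map_finRange, encodeSet, List.map_map]
  refine List.map_congr_left fun v _ => ?_
  have : (Finset.univ.filter fun u => decide (u ∈ G.nbr w) = true ∧ u < v) =
      (G.nbr w).filter (· < v) := by
    ext u; simp
  rw [Function.comp, this]
  congr 1
  rw [Bool.eq_iff_iff, decide_eq_true_iff, Finset.mem_filter, Bool.and_eq_true,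
    decide_eq_true_iff]
  rfl

theorem encodeEntry_entry (w : Fin m) (a : ℕ) :
    encodeEntry (G.entry c b w a) = entryWord m (1 + (colourClass c b).card) (G.row w) a := by
  rw [encodeEntry, entryWord, marks_row, marks_row, count_row]
  simp [entry, encodeNumber, leftSet, rightSet, numRect]

theorem encodeEntry_emptyEntry :
    encodeEntry (G.emptyEntry c b) =
      Prog.emptyWord m (1 + (G.sparse c b).card) (1 + (colourClass c b).card) := by
  simp [encodeEntry, emptyEntry, Prog.emptyWord, encodeNumber, encodeSet]

/-- The list of entries has the order in which the program produces its word, including the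
decreasing index at each vertex. -/
theorem encodeListing_entries :
    encodeListing (G.entries c b) = Prog.listingWord b m (1 + (colourClass c b).card)
      ((List.finRange m).map fun w => (c w, G.row w)) := by
  rw [encodeListing, entries, List.flatMap_cons, encodeEntry_emptyEntry, Prog.listingWord]
  congr 1
  · congr 2
    rw [List.countP_map, sparse, colourClass, Finset.filter_filter]
    rw [List.countP_eq_length_filter, Finset.card_def, Finset.filter_val]
    have : (Finset.univ : Finset (Fin m)).val = (List.finRange m : Multiset (Fin m)) := rfl
    rw [this, Multiset.filter_coe, Multiset.coe_card]
    congr 2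
    funext u
    rw [Function.comp, count_row, Bool.beq_eq_decide_eq, ← Bool.decide_and]
    rfl
  · rw [List.flatMap_assoc, List.flatMap_map]
    congr 1
    funext w
    cases h : c w == b with
    | false => simp
    | true =>
      simp only [if_true, rowWord, count_row, List.flatMap_map]
      congr 1
      funext a
      exact G.encodeEntry_entry c b w a

theorem encodeInput_eq :
    encodeInput G c = List.replicate ((List.finRange m).map fun w => (c w, G.row w)).length true ++
      false :: ((((List.finRange m).map fun w => (c w, G.row w)).map Prod.snd).flatten ++
        ((List.finRange m).map fun w => (c w, G.row w)).map Prod.fst) := by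
  simp [encodeInput, List.flatMap, row, Function.comp_def]

theorem outputsWithin_entries :
    OutputsWithin (Cmd.machine (Prog.listing b) .inp (Prog.seenVar none 0)) (encodeInput G c)
      (encodeListing (G.entries c b))
      (Prog.listingTime m (1 + (colourClass c b).card) + 1) := by
  apply Cmd.machine_outputsWithin
  have h := Prog.runs_listing b ((List.finRange m).map fun w => (c w, G.row w))
    (by simp [row])
  rw [← encodeInput_eq] at h
  have e : (((List.finRange m).map fun w => (c w, G.row w)).map Prod.fst).count b =
      (colourClass c b).card := by
    rw [List.map_map]
    exact count_map_finRange c b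
  rw [e, List.length_map, List.length_finRange, ← encodeListing_entries] at h
  have e1 : ({ inp := encodeInput G c } : Stacks).get =
      Function.update (fun _ => []) .inp (encodeInput G c) := by
    funext k; cases k <;> rfl
  have e2 : ({} : Stacks).get = fun _ => [] := by
    funext k; cases k <;> rfl
  rw [Runs, e1, e2] at h
  exact h

end Multigraph

theorem listingTime_le {m n : ℕ} (hm : 2 ≤ m) (hn : n ≤ m + 1) :
    Prog.listingTime m n + 1 ≤ m ^ 20 := by
  -- Since `m + 1 ≤ m ^ 2` for `m ≥ 2`, the bound becomes a polynomial in `m` alone.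
  have h1 : Prog.listingTime m n ≤ Prog.listingTime m (m ^ 2) := by
    have : n ≤ m ^ 2 := by nlinarith
    unfold Prog.listingTime Prog.listRowTime
    gcongr
  have hp : ∀ i ≤ 8, m ^ i ≤ m ^ 8 := fun i hi => Nat.pow_le_pow_right (by omega) hi
  -- Each monomial is at most `m ^ 8`, and `2 ^ 12` exceeds the sum of the coefficients; afterwards
  -- `2 ≤ m` absorbs the constant into the exponent.
  have h2 : Prog.listingTime m (m ^ 2) + 1 ≤ 2 ^ 12 * m ^ 8 := by
    unfold Prog.listingTime Prog.listRowTime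
    have h0 := hp 0 (by norm_num)
    have h1 := hp 1 (by norm_num)
    have h2 := hp 2 (by norm_num)
    have h3 := hp 3 (by norm_num)
    have h4 := hp 4 (by norm_num)
    have h5 := hp 5 (by norm_num)
    have h6 := hp 6 (by norm_num)
    have h7 := hp 7 (by norm_num)
    ring_nf at *
    omega
  calc Prog.listingTime m n + 1 ≤ 2 ^ 12 * m ^ 8 := by omega
    _ ≤ m ^ 12 * m ^ 8 := Nat.mul_le_mul_right _ (Nat.pow_le_pow_left hm 12)
    _ = m ^ 20 := by ring

/-! ### The distribution of a list of rectangles -/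

/-- The probability of an entry. -/
noncomputable def ListEntry.weight {m : ℕ} (e : ListEntry m) : ℝ := (e.num : ℝ) / (e.den : ℝ)

section ListDistribution

variable {m : ℕ}

open scoped Classical in
theorem sum_weight_filter (L : List (ListEntry m)) (P : Finset (Finset (Fin m × Fin m))) :
    ∑ R ∈ P, (L.map fun e => if e.rect = R then e.weight else 0).sum =
      (L.map fun e => if e.rect ∈ P then e.weight else 0).sum := by
  induction L with
  | nil => simp
  | cons e L ih => simp [Finset.sum_add_distrib, ih]

theorem sum_weight_of_nodup (L : List (ListEntry m)) (hL : (L.map ListEntry.rect).Nodup)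
    (e : ListEntry m) (he : e ∈ L) :
    (L.map fun e' => if e'.rect = e.rect then e'.weight else 0).sum = e.weight := by
  induction L with
  | nil => simp at he
  | cons a L ih =>
    rw [List.map_cons, List.nodup_cons] at hL
    rcases List.mem_cons.1 he with rfl | h
    · have : (L.map fun e' => if e'.rect = e.rect then e'.weight else 0) = L.map fun _ => 0 := by
        refine List.map_congr_left fun a ha => if_neg fun h => hL.1 ?_
        rw [← h]
        exact List.mem_map_of_mem ha
      simp [this]
    · have : a.rect ≠ e.rect := fun h' => hL.1 (h' ▸ List.mem_map_of_mem h)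
      simp [this, ih hL.2 h]

theorem weight_nonneg (e : ListEntry m) : 0 ≤ e.weight := by
  unfold ListEntry.weight; positivity

open scoped Classical in
-- The mass of a set is the total weight of the entries with that rectangle, of which there is at
-- most one. Positive numerators make the support equal to the list.
theorem exists_pmf_isListing (L : List (ListEntry m)) (hL : (L.map ListEntry.rect).Nodup)
    (hden : ∀ e ∈ L, 0 < e.den) (hnum : ∀ e ∈ L, 0 < e.num)
    (hsum : (L.map ListEntry.weight).sum = 1) :
    ∃ μ : PMF (Finset (Fin m × Fin m)), IsListing μ L ∧
      (∀ R, ∃ q : ℚ, (μ R).toReal = (q : ℝ)) ∧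
      ∀ P : Set (Finset (Fin m × Fin m)), (μ.toOuterMeasure P).toReal =
        (L.map fun e => if e.rect ∈ P then e.weight else 0).sum := by
  set f : Finset (Fin m × Fin m) → ℝ :=
    fun R => (L.map fun e => if e.rect = R then e.weight else 0).sum with hf
  have hf0 : ∀ R, 0 ≤ f R := fun R => List.sum_nonneg fun x hx => by
    obtain ⟨e, _, rfl⟩ := List.mem_map.1 hx
    split_ifs
    exacts [weight_nonneg e, le_rfl]
  have hf1 : ∑ R, ENNReal.ofReal (f R) = 1 := by
    rw [← ENNReal.ofReal_sum_of_nonneg fun R _ => hf0 R, hf, sum_weight_filter]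
    simp only [Finset.mem_univ, if_true]
    rw [show (L.map fun e => e.weight) = L.map ListEntry.weight from rfl, hsum, ENNReal.ofReal_one]
  set μ := PMF.ofFintype (fun R => ENNReal.ofReal (f R)) hf1 with hμ
  have hval : ∀ R, (μ R).toReal = f R := fun R => by
    rw [hμ, PMF.ofFintype_apply, ENNReal.toReal_ofReal (hf0 R)]
  have hmem : ∀ e ∈ L, f e.rect = e.weight := fun e he => sum_weight_of_nodup L hL e he
  have hzero : ∀ R, R ∉ L.map ListEntry.rect → f R = 0 := fun R hR => by
    have : (L.map fun e => if e.rect = R then e.weight else 0) = L.map fun _ => 0 :=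
      List.map_congr_left fun a ha => if_neg fun h => hR (by
        rw [← h]; exact List.mem_map_of_mem ha)
    rw [hf]
    simp [this]
  refine ⟨μ, ⟨hL, fun R => ?_, hden, fun e he => (hval _).trans (hmem e he)⟩, fun R => ?_,
    fun P => ?_⟩
  · rw [PMF.mem_support_iff]
    constructor
    · intro h
      obtain ⟨e, he, rfl⟩ := List.mem_map.1 h
      intro h0
      have h1 := hval e.rect
      rw [h0, hmem e he, ListEntry.weight] at h1
      have h2 : (0 : ℝ) < e.num := by exact_mod_cast hnum e he
      have h3 : (0 : ℝ) < e.den := by exact_mod_cast hden e he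
      have : (0 : ℝ) < (e.num : ℝ) / e.den := by positivity
      simp only [ENNReal.toReal_zero] at h1
      linarith
    · intro h
      by_contra h'
      apply h
      rw [hμ, PMF.ofFintype_apply, hzero R h', ENNReal.ofReal_zero]
  · by_cases hR : R ∈ L.map ListEntry.rect
    · obtain ⟨e, he, rfl⟩ := List.mem_map.1 hR
      exact ⟨(e.num : ℚ) / e.den, by rw [hval, hmem e he, ListEntry.weight]; push_cast; rfl⟩
    · exact ⟨0, by rw [hval, hzero R hR, Rat.cast_zero]⟩
  · rw [PMF.toOuterMeasure_apply_fintype, ENNReal.toReal_sum]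
    · have h1 := sum_weight_filter L (Finset.univ.filter (· ∈ P))
      simp only [Finset.mem_filter, Finset.mem_univ, true_and] at h1
      rw [← h1, Finset.sum_filter]
      refine Finset.sum_congr rfl fun R _ => ?_
      by_cases hR : R ∈ P
      · rw [Set.indicator_of_mem hR, if_pos hR, hval]
      · rw [Set.indicator_of_notMem hR, if_neg hR, ENNReal.toReal_zero]
    · intro R _
      by_cases hR : R ∈ P
      · rw [Set.indicator_of_mem hR]; exact PMF.apply_ne_top _ _
      · rw [Set.indicator_of_notMem hR]; exact ENNReal.zero_ne_top

end ListDistribution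

/-! ### Distinctness of the rectangles and the resulting distribution. -/

namespace Multigraph

variable {m : ℕ} (G : Multigraph (Fin m)) (c : Fin m → Bool) (b : Bool)

theorem mem_nbr_comm {u w : Fin m} : u ∈ G.nbr w ↔ w ∈ G.nbr u := by
  simp [nbr, G.symm u w]

theorem pos_lt_pos {w u v : Fin m} (hu : u ∈ G.nbr w) (h : u < v) : G.pos w u < G.pos w v := by
  refine Finset.card_lt_card ((Finset.ssubset_iff_of_subset fun x hx => ?_).2 ⟨u, ?_, ?_⟩)
  · rw [Finset.mem_filter] at hx ⊢
    exact ⟨hx.1, hx.2.trans h⟩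
  · exact Finset.mem_filter.2 ⟨hu, h⟩
  · simp

theorem pos_injOn (w : Fin m) : Set.InjOn (G.pos w) (G.nbr w) := by
  intro u hu v hv h
  rcases lt_trichotomy u v with h' | h' | h'
  · exact absurd h (G.pos_lt_pos hu h').ne
  · exact h'
  · exact absurd h (G.pos_lt_pos hv h').ne'

theorem pos_lt_card {w u : Fin m} (hu : u ∈ G.nbr w) : G.pos w u < (G.nbr w).card := by
  refine Finset.card_lt_card ((Finset.ssubset_iff_of_subset (Finset.filter_subset _ _)).2
    ⟨u, hu, by simp⟩)

/-- An injective map into a set of the same size is onto, so each position is taken by a neighbour.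
-/
theorem image_pos (w : Fin m) : (G.nbr w).image (G.pos w) = Finset.range (G.nbr w).card := by
  refine Finset.eq_of_subset_of_card_le (fun s hs => ?_) ?_
  · obtain ⟨u, hu, rfl⟩ := Finset.mem_image.1 hs
    exact Finset.mem_range.2 (G.pos_lt_card hu)
  · rw [Finset.card_range, Finset.card_image_of_injOn (G.pos_injOn w)]

theorem exists_pos_eq {w : Fin m} {s : ℕ} (hs : s < (G.nbr w).card) :
    ∃ u ∈ G.nbr w, G.pos w u = s := by
  rw [← Finset.mem_range, ← image_pos] at hs
  simpa using hs

variable {G c b} in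
theorem eq_of_mem_nbr (hG : G.AtMostOneCommonNbr) {u v w w' : Fin m} (huv : u ≠ v)
    (hu : u ∈ G.nbr w) (hv : v ∈ G.nbr w) (hu' : u ∈ G.nbr w') (hv' : v ∈ G.nbr w') : w = w' :=
  Finset.card_le_one.1 (hG u v huv) w (Finset.mem_inter.2 ⟨G.mem_nbr_comm.1 hu, G.mem_nbr_comm.1 hv⟩)
    w' (Finset.mem_inter.2 ⟨G.mem_nbr_comm.1 hu', G.mem_nbr_comm.1 hv'⟩)

theorem disjoint_leftSet_rightSet (w : Fin m) (a : ℕ) :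
    Disjoint (G.leftSet w a) (G.rightSet w a) := by
  rw [Finset.disjoint_left]
  intro u h1 h2
  have h1 := (Finset.mem_filter.1 h1).2
  have h2 := (Finset.mem_filter.1 h2).2
  simp only [leftAt, rightAt, Bool.or_eq_true, decide_eq_true_eq, Bool.and_eq_true,
    Bool.not_eq_true', decide_eq_false_iff_not] at h1 h2
  rcases h1 with h1 | ⟨⟨h1, _⟩, h3⟩ <;> rcases h2 with h2 | ⟨⟨h2, _⟩, h4⟩
  · omega
  · omega
  · omega
  · rw [h3] at h4
    exact Bool.false_ne_true h4

theorem gadget_eq (hG : G.AtMostOneCommonNbr) {u v w : Fin m} (huv : u ≠ v)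
    (hu : u ∈ G.nbr w) (hv : v ∈ G.nbr w) : G.gadget c u v = some (c w) := by
  have hw : w ∈ G.nbr u ∩ G.nbr v :=
    Finset.mem_inter.2 ⟨G.mem_nbr_comm.1 hu, G.mem_nbr_comm.1 hv⟩
  have huniq : ∀ w' ∈ G.nbr u ∩ G.nbr v, w' = w := fun w' h' =>
    Finset.card_le_one.1 (hG u v huv) w' h' w hw
  unfold gadget
  cases h : c w with
  | true => rw [if_pos ⟨huv, w, hw, h⟩]
  | false =>
    rw [if_neg, if_pos ⟨huv, w, hw, h⟩]
    rintro ⟨_, w', h', h1⟩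
    rw [huniq w' h', h] at h1
    exact Bool.false_ne_true h1

/-- The neighbours in positions 0 and 1 lie on their sides for every index; they identify `w`. -/
theorem exists_first (w : Fin m) (a : ℕ) (ha : a < G.numRect w) :
    ∃ u ∈ G.leftSet w a, ∃ v ∈ G.rightSet w a, ∀ a', u ∈ G.leftSet w a' ∧ v ∈ G.rightSet w a' := by
  unfold numRect at ha
  obtain ⟨u, hu, hu0⟩ := G.exists_pos_eq (w := w) (s := 0) (by omega)
  obtain ⟨v, hv, hv0⟩ := G.exists_pos_eq (w := w) (s := 1) (by omega)
  have h1 : ∀ a', u ∈ G.leftSet w a' := fun a' => Finset.mem_filter.2 ⟨hu, by simp [leftAt, hu0]⟩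
  have h2 : ∀ a', v ∈ G.rightSet w a' := fun a' => Finset.mem_filter.2 ⟨hv, by simp [rightAt, hv0]⟩
  exact ⟨u, h1 a, v, h2 a, fun a' => ⟨h1 a', h2 a'⟩⟩

theorem rect_entry_ne_empty {w : Fin m} {a : ℕ} (ha : a < G.numRect w) :
    (G.entry c b w a).rect ≠ ∅ := by
  obtain ⟨u, hu, v, hv, _⟩ := G.exists_first w a ha
  exact Finset.Nonempty.ne_empty ⟨(u, v), Finset.mem_product.2 ⟨hu, hv⟩⟩

/-- The two fixed vertices of the first rectangle are also common neighbours, in the second one, of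
`w'`, whence `w = w'`. For `a ≠ a'` the neighbour of rank `a` is missing from rectangle `a` but lies
on one side of rectangle `a'`. -/
theorem rect_entry_inj (hG : G.AtMostOneCommonNbr) {w w' : Fin m} {a a' : ℕ} (ha : a < G.numRect w)
    (h : (G.entry c b w a).rect = (G.entry c b w' a').rect) : w = w' ∧ a = a' := by
  obtain ⟨u, hu, v, hv, huv⟩ := G.exists_first w a ha
  have h1 : (u, v) ∈ (G.entry c b w' a').rect := h ▸ Finset.mem_product.2 ⟨hu, hv⟩
  have h2 := Finset.mem_product.1 h1
  have hne : u ≠ v := fun e =>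
    Finset.disjoint_left.1 (G.disjoint_leftSet_rightSet w a) hu (e ▸ hv)
  obtain rfl : w = w' := eq_of_mem_nbr hG hne (Finset.mem_filter.1 hu).1 (Finset.mem_filter.1 hv).1
    (Finset.mem_filter.1 h2.1).1 (Finset.mem_filter.1 h2.2).1
  refine ⟨rfl, ?_⟩
  by_contra hne
  obtain ⟨z, hz, hz0⟩ := G.exists_pos_eq (w := w) (s := a + 2) (by unfold numRect at ha; omega)
  have hl : z ∉ G.leftSet w a := fun hz' => by
    have := (Finset.mem_filter.1 hz').2
    simp [leftAt, hz0] at this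
  have hr : z ∉ G.rightSet w a := fun hz' => by
    have := (Finset.mem_filter.1 hz').2
    simp [rightAt, hz0] at this
  have hne' : ¬ a' = a := fun e => hne e.symm
  -- Pairing `z` with the fixed vertex of the opposite side gives a point of the second rectangle
  -- outside the first.
  have hz1 : z ∈ G.leftSet w a' ∨ z ∈ G.rightSet w a' := by
    cases hi : inner2 m a' a with
    | true => exact Or.inr (Finset.mem_filter.2 ⟨hz, by simp [rightAt, hz0, hi, hne']⟩)
    | false => exact Or.inl (Finset.mem_filter.2 ⟨hz, by simp [leftAt, hz0, hi, hne']⟩)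
  rcases hz1 with hz1 | hz1
  · have h3 : (z, v) ∈ (G.entry c b w a).rect :=
      h ▸ Finset.mem_product.2 ⟨hz1, (huv a').2⟩
    exact hl (Finset.mem_product.1 h3).1
  · have h3 : (u, z) ∈ (G.entry c b w a).rect :=
      h ▸ Finset.mem_product.2 ⟨(huv a').1, hz1⟩
    exact hr (Finset.mem_product.1 h3).2

variable {G c b} in
theorem mem_entries {e : ListEntry m} : e ∈ G.entries c b ↔ e = G.emptyEntry c b ∨
    ∃ w a, c w = b ∧ a < G.numRect w ∧ e = G.entry c b w a := by
  simp only [entries, List.mem_cons, List.mem_flatMap, List.mem_finRange, true_and]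
  refine or_congr_right ⟨?_, ?_⟩
  · rintro ⟨w, hw⟩
    split_ifs at hw with h
    · obtain ⟨a, ha, rfl⟩ := List.mem_map.1 hw
      exact ⟨w, a, by simpa using h, by simpa using ha, rfl⟩
    · simp at hw
  · rintro ⟨w, a, hw, ha, rfl⟩
    refine ⟨w, ?_⟩
    rw [if_pos (by simpa using hw)]
    exact List.mem_map_of_mem (by simpa using ha)

theorem nodup_entries (hG : G.AtMostOneCommonNbr) :
    ((G.entries c b).map ListEntry.rect).Nodup := by
  rw [entries, List.map_cons, List.nodup_cons]
  constructor
  · intro h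
    obtain ⟨e, he, h⟩ := List.mem_map.1 h
    obtain ⟨w, _, hw⟩ := List.mem_flatMap.1 he
    split_ifs at hw with hc
    · obtain ⟨a, ha, rfl⟩ := List.mem_map.1 hw
      exact G.rect_entry_ne_empty c b (by simpa using ha) h
    · simp at hw
  · rw [List.map_flatMap, List.nodup_flatMap]
    constructor
    · intro w _
      split_ifs
      · rw [List.map_map]
        refine List.Nodup.map_on (fun a ha a' _ h => ?_) (List.nodup_reverse.2 List.nodup_range)
        exact (G.rect_entry_inj c b hG (by simpa using ha) h).2
      · simp
    · refine (List.nodup_finRange m).imp fun {w w'} hne => ?_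
      rw [Function.onFun, List.disjoint_left]
      intro R h1 h2
      obtain ⟨e1, he1, rfl⟩ := List.mem_map.1 h1
      obtain ⟨e2, he2, h⟩ := List.mem_map.1 h2
      split_ifs at he1 with hc1
      · split_ifs at he2 with hc2
        · obtain ⟨a1, ha1, rfl⟩ := List.mem_map.1 he1
          obtain ⟨a2, ha2, rfl⟩ := List.mem_map.1 he2
          exact hne (G.rect_entry_inj c b hG (by simpa using ha1) h.symm).1
        · simp at he2
      · simp at he1

theorem sum_entries (F : ListEntry m → ℝ) :
    ((G.entries c b).map F).sum = F (G.emptyEntry c b) +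
      ∑ w ∈ colourClass c b, ∑ a ∈ Finset.range (G.numRect w), F (G.entry c b w a) := by
  rw [entries, List.map_cons, List.sum_cons, colourClass, Finset.sum_filter]
  congr 1
  have : ∀ l : List (Fin m), ((l.flatMap fun w =>
      if c w == b then (List.range (G.numRect w)).reverse.map (G.entry c b w) else []).map F).sum =
      (l.map fun w => if c w = b then
        ∑ a ∈ Finset.range (G.numRect w), F (G.entry c b w a) else 0).sum := by
    intro l
    induction l with
    | nil => rfl
    | cons w l ih =>
      rw [List.flatMap_cons, List.map_append, List.sum_append, ih, List.map_cons, List.sum_cons]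
      congr 1
      by_cases h : c w = b
      · rw [if_pos (by simpa using h), if_pos h, List.map_map, List.map_reverse, List.sum_reverse]
        rfl
      · rw [if_neg (by simpa using h), if_neg h]
        rfl
  rw [this, ← List.sum_toFinset _ (List.nodup_finRange m)]
  congr 1
  ext; simp

/-- A vertex with rectangles contributes `1 / (1 + N)` in total. The shares of the other vertices of
colour `b` and of the phantom element are the numerator of the empty rectangle. -/
theorem sum_weight_entries : ((G.entries c b).map ListEntry.weight).sum = 1 := by
  rw [sum_entries]
  have h1 : ∀ w ∈ colourClass c b,
      ∑ a ∈ Finset.range (G.numRect w), (G.entry c b w a).weight =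
        (if G.numRect w = 0 then 0 else 1) * (1 / (1 + ((colourClass c b).card : ℝ))) := by
    intro w _
    simp only [ListEntry.weight, entry, Finset.sum_const, Finset.card_range, nsmul_eq_mul]
    split_ifs with h
    · simp [h]
    · have : (G.numRect w : ℝ) ≠ 0 := by exact_mod_cast h
      have h2 : (1 + ((colourClass c b).card : ℝ)) ≠ 0 := by positivity
      push_cast
      field_simp
  rw [Finset.sum_congr rfl h1, ← Finset.sum_mul]
  have h2 : ∑ w ∈ colourClass c b, (if G.numRect w = 0 then (0 : ℝ) else 1) =
      (colourClass c b).card - (G.sparse c b).card := by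
    have e := Finset.card_filter_add_card_filter_not (s := colourClass c b) (fun w => G.numRect w = 0)
    rw [sparse, ← e, Finset.sum_ite]
    simp
  rw [h2]
  simp only [ListEntry.weight, emptyEntry]
  have h3 : (1 + ((colourClass c b).card : ℝ)) ≠ 0 := by positivity
  push_cast
  field_simp
  ring

open scoped Classical in
-- Only a lower bound is claimed for the mass of `P`: the term of the empty rectangle is nonnegative
-- and is dropped.
theorem exists_distribution (hG : G.AtMostOneCommonNbr) :
    ∃ μ : PMF (Finset (Fin m × Fin m)),
      IsOverMonoRectangles (G.gadget c) b μ ∧ IsListing μ (G.entries c b) ∧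
      (∀ R, ∃ q : ℚ, (μ R).toReal = (q : ℝ)) ∧
      ∀ P : Set (Finset (Fin m × Fin m)),
        ∑ w ∈ colourClass c b, ((Finset.range (G.numRect w)).filter fun a =>
            G.leftSet w a ×ˢ G.rightSet w a ∈ P).card /
          ((G.numRect w : ℝ) * (1 + (colourClass c b).card)) ≤ (μ.toOuterMeasure P).toReal := by
  obtain ⟨μ, hμ, hq, hP⟩ := exists_pmf_isListing (G.entries c b) (G.nodup_entries c b hG)
    (fun e he => by
      rcases mem_entries.1 he with rfl | ⟨w, a, _, ha, rfl⟩
      · simp [emptyEntry]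
      · exact Nat.mul_pos (by omega) (by omega))
    (fun e he => by
      rcases mem_entries.1 he with rfl | ⟨w, a, _, ha, rfl⟩
      · simp [emptyEntry]
      · simp [entry]) (G.sum_weight_entries c b)
  refine ⟨μ, fun R hR => ?_, hμ, hq, fun P => ?_⟩
  · obtain ⟨e, he, rfl⟩ := List.mem_map.1 ((hμ.mem_iff R).2 hR)
    refine ⟨⟨_, _, rfl⟩, fun q hq => ?_⟩
    rcases mem_entries.1 he with rfl | ⟨w, a, hw, ha, rfl⟩
    · simp [ListEntry.rect, emptyEntry] at hq
    · have h := Finset.mem_product.1 hq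
      rw [G.gadget_eq c hG (w := w) _ (Finset.mem_filter.1 h.1).1 (Finset.mem_filter.1 h.2).1, hw]
      exact fun e => Finset.disjoint_left.1 (G.disjoint_leftSet_rightSet w a) h.1 (e ▸ h.2)
  · rw [hP, sum_entries]
    have h0 : 0 ≤ if (G.emptyEntry c b).rect ∈ P then (G.emptyEntry c b).weight else 0 := by
      split_ifs
      exacts [weight_nonneg _, le_rfl]
    refine le_add_of_nonneg_of_le h0 (Finset.sum_le_sum fun w _ => le_of_eq ?_)
    rw [← Finset.sum_filter]
    simp only [ListEntry.weight, entry, ListEntry.rect, Finset.sum_const, nsmul_eq_mul]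
    push_cast
    rw [mul_one_div]
    congr!

end Multigraph

/-! ### Second moment of inner products modulo 2 -/

theorem inner2_succ (n x y : ℕ) :
    inner2 (n + 1) x y = xor (decide (x % 2 = 1) && decide (y % 2 = 1)) (inner2 n (x / 2) (y / 2)) :=
  rfl

theorem inner2_zero_right (n x : ℕ) : inner2 n x 0 = false := by
  induction n generalizing x with
  | zero => rfl
  | succ n ih => simp [inner2_succ, ih]

/-- Digits of `x` beyond the length of `y` meet zeros. The machine works with width `m`, the second
moment with the least sufficient width. -/
theorem inner2_eq_of_lt {n m x y : ℕ} (hy : y < 2 ^ n) (hnm : n ≤ m) :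
    inner2 m x y = inner2 n x y := by
  induction n generalizing m x y with
  | zero =>
    obtain rfl : y = 0 := by omega
    rw [inner2_zero_right, inner2_zero_right]
  | succ n ih =>
    obtain ⟨m, rfl⟩ : ∃ k, m = k + 1 := ⟨m - 1, by omega⟩
    rw [inner2_succ, inner2_succ, ih (by omega) (by omega)]

/-- The sign of an inner product modulo 2. -/
def signOf (n x y : ℕ) : ℝ := if inner2 n x y then -1 else 1

theorem signOf_mul_self (n x y : ℕ) : signOf n x y * signOf n x y = 1 := by
  unfold signOf; split_ifs <;> norm_num

theorem signOf_succ (n x y : ℕ) :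
    signOf (n + 1) x y = (if x % 2 = 1 ∧ y % 2 = 1 then -1 else 1) * signOf n (x / 2) (y / 2) := by
  unfold signOf
  rw [inner2_succ]
  by_cases h1 : x % 2 = 1 <;> by_cases h2 : y % 2 = 1 <;>
    cases inner2 n (x / 2) (y / 2) <;> simp [h1, h2]

theorem sum_range_two_mul (F : ℕ → ℝ) (k : ℕ) :
    ∑ a ∈ Finset.range (2 * k), F a = ∑ a ∈ Finset.range k, (F (2 * a) + F (2 * a + 1)) := by
  induction k with
  | zero => simp
  | succ k ih =>
    rw [Nat.mul_succ, Finset.sum_range_succ, Finset.sum_range_succ, ih, Finset.sum_range_succ]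
    ring

/-- Orthogonality of the characters of `(ℤ/2)^n`, by induction on the number of digits. -/
theorem sum_signOf_mul {n x y : ℕ} (hx : x < 2 ^ n) (hy : y < 2 ^ n) (hxy : x ≠ y) :
    ∑ a ∈ Finset.range (2 ^ n), signOf n a x * signOf n a y = 0 := by
  induction n generalizing x y with
  | zero => omega
  | succ n ih =>
    rw [pow_succ', sum_range_two_mul]
    -- Pairing `2a` with `2a + 1` sums over the lowest digit of the index. The factor vanishes if
    -- the lowest digits of `x` and `y` differ; otherwise the higher ones differ and induction
    -- applies.
    have h : ∀ a, signOf (n + 1) (2 * a) x * signOf (n + 1) (2 * a) y +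
        signOf (n + 1) (2 * a + 1) x * signOf (n + 1) (2 * a + 1) y =
        (1 + (if x % 2 = 1 then -1 else 1) * (if y % 2 = 1 then -1 else 1)) *
          (signOf n a (x / 2) * signOf n a (y / 2)) := by
      intro a
      simp only [signOf_succ]
      have e1 : 2 * a / 2 = a := by omega
      have e2 : (2 * a + 1) / 2 = a := by omega
      have e3 : 2 * a % 2 = 0 := by omega
      have e4 : (2 * a + 1) % 2 = 1 := by omega
      rw [e1, e2, e3, e4]
      simp only [zero_ne_one, false_and, if_false, true_and]
      ring
    rw [Finset.sum_congr rfl fun a _ => h a, ← Finset.mul_sum]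
    by_cases h2 : x / 2 = y / 2
    · have : (1 + (if x % 2 = 1 then (-1 : ℝ) else 1) * (if y % 2 = 1 then -1 else 1)) = 0 := by
        rcases Nat.mod_two_eq_zero_or_one x with h3 | h3 <;>
          rcases Nat.mod_two_eq_zero_or_one y with h4 | h4
        · omega
        · simp [h3, h4]
        · simp [h3, h4]
        · omega
      rw [this, zero_mul]
    · rw [ih (by omega) (by omega) h2, mul_zero]

theorem sum_sq_signOf {n : ℕ} (A : Finset ℕ) (hA : ∀ x ∈ A, x < 2 ^ n) :
    ∑ a ∈ Finset.range (2 ^ n), (∑ x ∈ A, signOf n a x) ^ 2 = 2 ^ n * (A.card : ℝ) := by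
  have h : ∀ a, (∑ x ∈ A, signOf n a x) ^ 2 = ∑ x ∈ A, ∑ y ∈ A, signOf n a x * signOf n a y := by
    intro a
    rw [sq, Finset.sum_mul_sum]
  rw [Finset.sum_congr rfl fun a _ => h a, Finset.sum_comm]
  have h1 : ∀ x ∈ A, ∑ a ∈ Finset.range (2 ^ n), ∑ y ∈ A, signOf n a x * signOf n a y =
      2 ^ n := by
    intro x hx
    rw [Finset.sum_comm, Finset.sum_eq_single_of_mem x hx]
    · simp [signOf_mul_self]
    · intro y hy hne
      exact sum_signOf_mul (hA x hx) (hA y hy) hne.symm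
  rw [Finset.sum_congr rfl h1, Finset.sum_const, nsmul_eq_mul, mul_comm]

/-- `D` need not be a power of two. Enlarging the range of indices to the next power, at most `2D`,
only adds squares and costs a factor 2. -/
theorem sum_sq_signOf_le {m D : ℕ} (hD : D ≤ m) (A : Finset ℕ) (hA : ∀ x ∈ A, x < D) :
    ∑ a ∈ Finset.range D, (∑ x ∈ A, signOf m a x) ^ 2 ≤ 2 * D * (A.card : ℝ) := by
  rcases Nat.eq_zero_or_pos D with rfl | hpos
  · simp
  set n := Nat.clog 2 D with hn
  have h1 : D ≤ 2 ^ n := Nat.le_pow_clog (by norm_num) D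
  have h2 : 2 ^ n ≤ 2 * D := by
    rcases Nat.lt_or_ge 1 D with h | h
    · have h3 := Nat.pow_pred_clog_lt_self (b := 2) (by norm_num) h
      have h4 : 0 < n := Nat.clog_pos (by norm_num) h
      obtain ⟨k, hk⟩ : ∃ k, n = k + 1 := ⟨n - 1, by omega⟩
      rw [← hn, hk, Nat.pred_succ] at h3
      rw [hk, pow_succ]
      omega
    · obtain rfl : D = 1 := by omega
      simp [hn]
  have hnm : n ≤ m := by
    refine Nat.clog_le_of_le_pow ?_
    exact hD.trans Nat.lt_two_pow_self.le
  have h3 : ∀ a, ∑ x ∈ A, signOf m a x = ∑ x ∈ A, signOf n a x := by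
    intro a
    refine Finset.sum_congr rfl fun x hx => ?_
    rw [signOf, signOf, inner2_eq_of_lt ((hA x hx).trans_le h1) hnm]
  simp only [h3]
  calc ∑ a ∈ Finset.range D, (∑ x ∈ A, signOf n a x) ^ 2
      ≤ ∑ a ∈ Finset.range (2 ^ n), (∑ x ∈ A, signOf n a x) ^ 2 :=
        Finset.sum_le_sum_of_subset_of_nonneg (Finset.range_mono h1) fun _ _ _ => sq_nonneg _
    _ = 2 ^ n * (A.card : ℝ) := sum_sq_signOf A fun x hx => (hA x hx).trans_le h1
    _ ≤ 2 * D * (A.card : ℝ) := by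
        refine mul_le_mul_of_nonneg_right ?_ (Nat.cast_nonneg _)
        exact_mod_cast h2

/-- Markov's inequality for the second moment: `196 = 2 · 98` and `9216 = 96²`. -/
theorem card_constant_le {m D : ℕ} (hD : D ≤ m) (A : Finset ℕ) (hA : ∀ x ∈ A, x < D)
    (hcard : A.card = 98) (β : Bool) :
    (((Finset.range D).filter fun a => ∀ x ∈ A, x ≠ a → inner2 m a x = β).card : ℝ) * 9216 ≤
      196 * D := by
  set B := (Finset.range D).filter fun a => ∀ x ∈ A, x ≠ a → inner2 m a x = β with hB
  have h := sum_sq_signOf_le hD A hA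
  rw [hcard] at h
  have h1 : ∀ a ∈ B, (9216 : ℝ) ≤ (∑ x ∈ A, signOf m a x) ^ 2 := by
    intro a ha
    have ha := (Finset.mem_filter.1 ha).2
    have h2 : (96 : ℝ) ≤ (if β then -1 else 1) * ∑ x ∈ A, signOf m a x := by
      -- The dropped rank `a` is the only one whose sign is not prescribed, and it costs at most 2,
      -- leaving `98 - 2 = 96`.
      have h3 : ∀ x ∈ A, (1 : ℝ) - (if x = a then 2 else 0) ≤
          (if β then -1 else 1) * signOf m a x := by
        intro x hx
        by_cases hxa : x = a
        · rw [if_pos hxa]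
          unfold signOf
          split_ifs <;> norm_num
        · rw [if_neg hxa, signOf, ha x hx hxa]
          cases β <;> norm_num
      rw [Finset.mul_sum]
      refine le_trans ?_ (Finset.sum_le_sum h3)
      rw [Finset.sum_sub_distrib, Finset.sum_ite_eq' A a, Finset.sum_const, hcard]
      split_ifs <;> norm_num
    have h4 : (∑ x ∈ A, signOf m a x) ^ 2 =
        ((if β then -1 else 1) * ∑ x ∈ A, signOf m a x) ^ 2 := by
      cases β <;> simp
    rw [h4]
    nlinarith
  calc (B.card : ℝ) * 9216 = ∑ a ∈ B, (9216 : ℝ) := by simp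
    _ ≤ ∑ a ∈ B, (∑ x ∈ A, signOf m a x) ^ 2 := Finset.sum_le_sum h1
    _ ≤ ∑ a ∈ Finset.range D, (∑ x ∈ A, signOf m a x) ^ 2 :=
        Finset.sum_le_sum_of_subset_of_nonneg (Finset.filter_subset _ _) fun _ _ _ => sq_nonneg _
    _ ≤ 196 * D := by push_cast at h; linarith

/-! ### Expansion -/

namespace Multigraph

open Matrix

variable {V : Type*} {G : Multigraph V} {m d : ℕ} {γ : ℝ}

theorem isHermitian_adjMat (G : Multigraph V) : G.adjMat.IsHermitian := by
  ext u v
  simp [adjMat, G.symm u v]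

variable [Fintype V]

theorem adjMat_mulVec_const (hd : G.IsRegular d) (r : ℝ) :
    G.adjMat *ᵥ (fun _ => r) = fun _ => d * r := by
  funext v
  simp only [mulVec, dotProduct, adjMat, of_apply]
  rw [← Finset.sum_mul, ← hd v]
  push_cast
  rfl

variable [DecidableEq V]

theorem parseval (x : V → ℝ) :
    ∑ j, ((G.isHermitian_adjMat.eigenvectorBasis j).ofLp ⬝ᵥ x) ^ 2 = x ⬝ᵥ x := by
  have h := G.isHermitian_adjMat.eigenvectorBasis.sum_sq_norm_inner_right (WithLp.toLp 2 x)
  rw [EuclideanSpace.norm_sq_eq] at h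
  simp only [Real.norm_eq_abs, sq_abs] at h
  rw [dotProduct, ← Finset.sum_congr rfl fun i _ => sq (x i), ← h]
  refine Finset.sum_congr rfl fun j _ => ?_
  rw [EuclideanSpace.inner_eq_star_dotProduct, dotProduct_comm]
  simp

/-- Expand in an orthonormal eigenbasis. Eigenvectors for `d` are constant because that eigenspace
is one-dimensional, so they are orthogonal to `x`; every other coordinate is scaled by at most `γ
d`. -/
theorem IsSpectralExpander.norm_mulVec_le (hG : G.IsSpectralExpander m d γ) (x : V → ℝ)
    (hx : ∑ v, x v = 0) :
    (G.adjMat *ᵥ x) ⬝ᵥ (G.adjMat *ᵥ x) ≤ (γ * d) ^ 2 * (x ⬝ᵥ x) := by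
  rw [← parseval (G := G) x, ← parseval (G := G) (G.adjMat *ᵥ x), Finset.mul_sum]
  refine Finset.sum_le_sum fun j _ => ?_
  set e : V → ℝ := (G.isHermitian_adjMat.eigenvectorBasis j).ofLp with he
  set ev := G.isHermitian_adjMat.eigenvalues j with hev
  have h1 : G.adjMat *ᵥ e = ev • e := G.isHermitian_adjMat.mulVec_eigenvectorBasis j
  have h2 : e ⬝ᵥ (G.adjMat *ᵥ x) = ev * (e ⬝ᵥ x) := by
    have hT : G.adjMatᵀ = G.adjMat := by
      ext u v; simp [adjMat, G.symm u v]
    rw [dotProduct_mulVec, ← mulVec_transpose, hT, h1, smul_dotProduct, smul_eq_mul]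
  have hne : e ≠ 0 := by
    intro h0
    have := G.isHermitian_adjMat.eigenvectorBasis.toBasis.ne_zero j
    apply this
    rw [OrthonormalBasis.coe_toBasis]
    ext v
    exact congrFun h0 v
  have hmem : e ∈ Module.End.eigenspace (Matrix.toLin' G.adjMat) ev := by
    rw [Module.End.mem_eigenspace_iff, toLin'_apply, h1]
  rw [h2]
  by_cases hd : ev = d
  · have hone : (fun _ => 1 : V → ℝ) ∈ Module.End.eigenspace (Matrix.toLin' G.adjMat) (d : ℝ) := by
      rw [Module.End.mem_eigenspace_iff, toLin'_apply, adjMat_mulVec_const hG.regular]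
      funext; simp
    obtain ⟨v0⟩ : Nonempty V := by
      by_contra h
      rw [not_nonempty_iff] at h
      exact hne (Subsingleton.elim _ _)
    have hone' : (⟨_, hone⟩ : Module.End.eigenspace (Matrix.toLin' G.adjMat) (d : ℝ)) ≠ 0 := by
      intro h
      have := congrFun (congrArg Subtype.val h) v0
      simp at this
    rw [hd] at hmem
    obtain ⟨r, hr⟩ := (finrank_eq_one_iff_of_nonzero' _ hone').1 hG.mult_one ⟨e, hmem⟩
    have hr' : e = fun _ => r := by
      have := congrArg Subtype.val hr
      funext v
      have := congrFun this v
      simpa using this.symm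
    have : e ⬝ᵥ x = 0 := by
      rw [hr', dotProduct, ← Finset.mul_sum, hx, mul_zero]
    simp [this]
  · have h3 := hG.other_le ev (Module.End.hasEigenvalue_of_hasEigenvector ⟨hmem, hne⟩) hd
    rw [mul_pow]
    refine mul_le_mul_of_nonneg_right ?_ (sq_nonneg _)
    rw [← sq_abs]
    exact pow_le_pow_left₀ (abs_nonneg _) h3 2

/-- For `d = 0` the matrix is zero and the eigenspace of 0 is the whole space, of dimension `m ≥ 2`.
Positivity allows `d ^ 2` to be cancelled later. -/
theorem IsSpectralExpander.degree_pos (hG : G.IsSpectralExpander m d γ) (hm : 2 ≤ m) : 0 < d := by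
  by_contra h
  obtain rfl : d = 0 := by omega
  have h0 : G.adjMat = 0 := by
    ext u v
    have := hG.regular u
    rw [Finset.sum_eq_zero_iff] at this
    simp [adjMat, this v (Finset.mem_univ v)]
  have h1 := hG.mult_one
  have h2 : Module.End.eigenspace (Matrix.toLin' G.adjMat) ((0 : ℕ) : ℝ) = ⊤ := by
    rw [h0]
    ext x
    simp
  rw [h2, finrank_top, Module.finrank_fintype_fun_eq_card, hG.card_eq] at h1
  omega

/-- Two sets without edges between them cannot both be large. -/
theorem IsSpectralExpander.card_mul_card_le (hG : G.IsSpectralExpander m d γ) (hm : 2 ≤ m)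
    (S X : Finset V) (h : ∀ s ∈ S, ∀ x ∈ X, G.mult s x = 0) :
    (S.card : ℝ) * X.card ≤ γ ^ 2 * (m : ℝ) ^ 2 := by
  have hd : (0 : ℝ) < d := by exact_mod_cast hG.degree_pos hm
  have hm0 : (0 : ℝ) < m := by exact_mod_cast (by omega : 0 < m)
  have hcard : ((Finset.univ : Finset V).card : ℝ) = m := by
    rw [Finset.card_univ, hG.card_eq]
  set p : ℝ := X.card / m with hp
  -- The indicator of `X` minus its mean, hence orthogonal to the constants. Applying the matrix and
  -- testing against the indicator of `S` leaves only the contribution of the mean, as there are no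
  -- edges.
  set x : V → ℝ := fun v => (if v ∈ X then 1 else 0) - p with hx
  set y : V → ℝ := fun v => if v ∈ S then 1 else 0 with hy
  have hx0 : ∑ v, x v = 0 := by
    simp only [hx, Finset.sum_sub_distrib, Finset.sum_const, hcard, nsmul_eq_mul,
      Finset.sum_ite_mem, Finset.univ_inter]
    rw [hp]
    field_simp
    simp
  have hxx : x ⬝ᵥ x ≤ X.card := by
    have : x ⬝ᵥ x = ∑ v, ((if v ∈ X then 1 else 0) - p * x v - p * (if v ∈ X then 1 else 0)) := by
      refine Finset.sum_congr rfl fun v _ => ?_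
      simp only [hx]
      split_ifs <;> ring
    rw [this, Finset.sum_sub_distrib, Finset.sum_sub_distrib, ← Finset.mul_sum, hx0,
      ← Finset.mul_sum]
    simp only [Finset.sum_ite_mem, Finset.univ_inter, Finset.sum_const, nsmul_eq_mul, mul_one,
      mul_zero, sub_zero]
    have : 0 ≤ p * X.card := by positivity
    linarith
  have hyy : y ⬝ᵥ y = S.card := by
    simp [hy, dotProduct]
  have hAx : y ⬝ᵥ (G.adjMat *ᵥ x) = - (d * p * S.card) := by
    have e1 : x = (fun v => if v ∈ X then 1 else 0) - fun _ => p := rfl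
    rw [e1, mulVec_sub, dotProduct_sub, adjMat_mulVec_const hG.regular]
    have e2 : y ⬝ᵥ (G.adjMat *ᵥ fun v => if v ∈ X then 1 else 0) = 0 := by
      refine Finset.sum_eq_zero fun s _ => ?_
      by_cases hs : s ∈ S
      · have : (G.adjMat *ᵥ fun v => if v ∈ X then (1 : ℝ) else 0) s = 0 := by
          refine Finset.sum_eq_zero fun v _ => ?_
          by_cases hv : v ∈ X
          · simp [adjMat, h s hs v hv]
          · simp [hv]
        rw [this, mul_zero]
      · simp [hy, hs]
    rw [e2, zero_sub, neg_inj]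
    simp only [dotProduct, hy, ite_mul, one_mul, zero_mul, Finset.sum_ite_mem, Finset.univ_inter,
      Finset.sum_const, nsmul_eq_mul]
    ring
  have hcs : (y ⬝ᵥ (G.adjMat *ᵥ x)) ^ 2 ≤
      (y ⬝ᵥ y) * ((G.adjMat *ᵥ x) ⬝ᵥ (G.adjMat *ᵥ x)) := by
    have := Finset.sum_mul_sq_le_sq_mul_sq Finset.univ y (G.adjMat *ᵥ x)
    simpa only [dotProduct, sq] using this
  have hle := hG.norm_mulVec_le x hx0
  rw [hAx, hyy] at hcs
  have h1 : (d * p * S.card) ^ 2 ≤ S.card * ((γ * d) ^ 2 * X.card) := by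
    have h2 : (γ * d) ^ 2 * (x ⬝ᵥ x) ≤ (γ * d) ^ 2 * X.card :=
      mul_le_mul_of_nonneg_left hxx (sq_nonneg _)
    calc (d * p * S.card) ^ 2 = (-(d * p * S.card)) ^ 2 := by ring
      _ ≤ _ := hcs
      _ ≤ _ := mul_le_mul_of_nonneg_left (hle.trans h2) (Nat.cast_nonneg _)
  -- The estimate carries a superfluous factor `|S| |X|`; assuming the contrary makes it positive,
  -- so that it cancels.
  by_contra hcon
  rw [not_le] at hcon
  have hpos : (0 : ℝ) < S.card * X.card := lt_of_le_of_lt (by positivity) hcon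
  have h3 : (S.card * X.card) * (S.card * X.card) ≤ (S.card * X.card) * (γ ^ 2 * (m : ℝ) ^ 2) := by
    have e : (d * p * S.card) ^ 2 * (m : ℝ) ^ 2 = d ^ 2 * ((S.card * X.card) * (S.card * X.card)) := by
      rw [hp]; field_simp
    have h4 := mul_le_mul_of_nonneg_right h1 (sq_nonneg (m : ℝ))
    rw [e] at h4
    have h5 : d ^ 2 * (((S.card : ℝ) * X.card) * (S.card * X.card)) ≤
        d ^ 2 * ((S.card * X.card) * (γ ^ 2 * (m : ℝ) ^ 2)) := by
      calc _ ≤ _ := h4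
        _ = _ := by ring
    exact le_of_mul_le_mul_left h5 (by positivity)
  exact absurd (le_of_mul_le_mul_left h3 hpos) (not_le.2 hcon)

/-- Few vertices have few neighbours in a large set. -/
theorem IsSpectralExpander.card_few_nbr_mul_le (hG : G.IsSpectralExpander m d γ) (hm : 2 ≤ m)
    (s k : ℕ) (X : Finset V) (hX : k * s ≤ X.card) :
    ((Finset.univ.filter fun w => (G.nbr w ∩ X).card < k).card : ℝ) * s ≤
      k * (γ ^ 2 * (m : ℝ) ^ 2) := by
  induction k generalizing X with
  | zero => simp
  | succ k ih =>
    rw [Nat.succ_mul] at hX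
    -- Split off a block of `s` vertices: a vertex with at most `k` neighbours in `X` either misses
    -- the block or has fewer than `k` neighbours in the rest.
    obtain ⟨Y, hYX, hY⟩ := Finset.exists_subset_card_eq (show s ≤ X.card by omega)
    have h1 := ih (X \ Y) (by rw [Finset.card_sdiff_of_subset hYX]; omega)
    have h2 := hG.card_mul_card_le hm (Finset.univ.filter fun w => G.nbr w ∩ Y = ∅) Y
      fun w hw y hy => by
        by_contra hne
        have : y ∈ G.nbr w ∩ Y := by
          simp only [nbr, Finset.mem_inter, Finset.mem_filter, Finset.mem_univ, true_and]
          exact ⟨by omega, hy⟩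
        rw [(Finset.mem_filter.1 hw).2] at this
        simp at this
    rw [hY] at h2
    have h3 : (Finset.univ.filter fun w => (G.nbr w ∩ X).card < k + 1) ⊆
        (Finset.univ.filter fun w => (G.nbr w ∩ (X \ Y)).card < k) ∪
          Finset.univ.filter fun w => G.nbr w ∩ Y = ∅ := by
      intro w hw
      simp only [Finset.mem_filter, Finset.mem_univ, true_and, Finset.mem_union] at hw ⊢
      by_contra hcon
      rw [not_or, not_lt] at hcon
      have h4 : 0 < (G.nbr w ∩ Y).card :=
        Finset.card_pos.2 (Finset.nonempty_iff_ne_empty.2 hcon.2)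
      have h5 : (G.nbr w ∩ (X \ Y)).card + (G.nbr w ∩ Y).card = (G.nbr w ∩ X).card := by
        rw [← Finset.card_union_of_disjoint, ← Finset.inter_union_distrib_left,
          Finset.sdiff_union_of_subset hYX]
        exact Finset.disjoint_of_subset_left Finset.inter_subset_right
          (Finset.disjoint_of_subset_right Finset.inter_subset_right Finset.sdiff_disjoint)
      omega
    have h4 := (Finset.card_le_card h3).trans (Finset.card_union_le _ _)
    have h5 : ((Finset.univ.filter fun w => (G.nbr w ∩ X).card < k + 1).card : ℝ) ≤
        (Finset.univ.filter fun w => (G.nbr w ∩ (X \ Y)).card < k).card +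
          (Finset.univ.filter fun w => G.nbr w ∩ Y = ∅).card := by exact_mod_cast h4
    have h6 := mul_le_mul_of_nonneg_right h5 (Nat.cast_nonneg (α := ℝ) s)
    push_cast
    linarith

end Multigraph

/-! ### The hitting property -/

theorem OutputsWithin.mono {M : Turing.TM2ComputableAux Bool (Option Bool)} {x : List Bool}
    {y : List (Option Bool)} {s t : ℕ} (h : OutputsWithin M x y s) (hst : s ≤ t) :
    OutputsWithin M x y t := by
  obtain ⟨e, he⟩ := h
  exact ⟨⟨e, he.trans hst⟩⟩

namespace Multigraph

variable {m : ℕ} (G : Multigraph (Fin m)) (c : Fin m → Bool) (b : Bool)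

/-- Of 100 neighbours in `X` at most two occupy the fixed positions 0 and 1, so 98 of them have
ranks. -/
theorem exists_ranks {w : Fin m} {X : Finset (Fin m)} (hX : 100 ≤ (G.nbr w ∩ X).card) :
    ∃ A : Finset ℕ, A.card = 98 ∧
      ∀ x ∈ A, x < G.numRect w ∧ ∃ v ∈ G.nbr w ∩ X, G.pos w v = x + 2 := by
  set P := (G.nbr w ∩ X).image (G.pos w) with hP
  have hcard : P.card = (G.nbr w ∩ X).card :=
    Finset.card_image_of_injOn fun u hu v hv h =>
      G.pos_injOn w (Finset.mem_inter.1 hu).1 (Finset.mem_inter.1 hv).1 h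
  have h1 : P.card - 2 ≤ (P \ Finset.range 2).card := by
    simpa using Finset.le_card_sdiff (Finset.range 2) P
  obtain ⟨Q, hQ, hQc⟩ := Finset.exists_subset_card_eq
    (show 98 ≤ (P \ Finset.range 2).card by omega)
  have h2 : ∀ s ∈ Q, 2 ≤ s ∧ ∃ v ∈ G.nbr w ∩ X, G.pos w v = s := by
    intro s hs
    have h3 := Finset.mem_sdiff.1 (hQ hs)
    exact ⟨not_lt.1 fun h => h3.2 (Finset.mem_range.2 h), Finset.mem_image.1 h3.1⟩
  refine ⟨Q.image (· - 2), ?_, ?_⟩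
  · rw [Finset.card_image_of_injOn, hQc]
    intro s hs t ht h
    have := (h2 s hs).1
    have := (h2 t ht).1
    simp only at h
    omega
  · intro x hx
    obtain ⟨s, hs, rfl⟩ := Finset.mem_image.1 hx
    obtain ⟨h3, v, hv, hvs⟩ := h2 s hs
    have h4 := G.pos_lt_card (Finset.mem_inter.1 hv).1
    refine ⟨by unfold numRect; omega, v, hv, by omega⟩

/-- Most rectangles of a vertex with many neighbours in both `X` and `Y` meet `X × Y`. -/
theorem le_card_hitting {w : Fin m} {X Y : Finset (Fin m)} (hX : 100 ≤ (G.nbr w ∩ X).card)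
    (hY : 100 ≤ (G.nbr w ∩ Y).card) (P : ℕ → Prop) [DecidablePred P]
    (hP : ∀ a, P a ↔ ¬ Disjoint (G.leftSet w a ×ˢ G.rightSet w a) (X ×ˢ Y)) :
    0 < G.numRect w ∧
      (19 / 20 : ℝ) * G.numRect w ≤ ((Finset.range (G.numRect w)).filter P).card := by
  obtain ⟨A, hA, hAX⟩ := G.exists_ranks hX
  obtain ⟨B, hB, hBY⟩ := G.exists_ranks hY
  have hpos : 0 < G.numRect w := by
    obtain ⟨x, hx⟩ := Finset.card_pos.1 (show 0 < A.card by omega)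
    exact (Nat.zero_le _).trans_lt (hAX x hx).1
  refine ⟨hpos, ?_⟩
  have hD : G.numRect w ≤ m := by
    have := Finset.card_le_univ (G.nbr w)
    rw [Fintype.card_fin] at this
    unfold numRect
    omega
  have h1 := card_constant_le hD A (fun x hx => (hAX x hx).1) hA true
  have h2 := card_constant_le hD B (fun x hx => (hBY x hx).1) hB false
  -- An index that fails to hit sends all of `A` right or all of `B` left, up to the dropped rank.
  -- Each occurs for at most `196 D / 9216` indices, together less than `D / 20`.
  have h3 : Finset.range (G.numRect w) ⊆ (Finset.range (G.numRect w)).filter P ∪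
      (((Finset.range (G.numRect w)).filter fun a => ∀ x ∈ A, x ≠ a → inner2 m a x = true) ∪
        (Finset.range (G.numRect w)).filter fun a => ∀ x ∈ B, x ≠ a → inner2 m a x = false) := by
    intro a ha
    simp only [Finset.mem_union, Finset.mem_filter, ha, true_and]
    by_contra hcon
    push Not at hcon
    obtain ⟨hnP, ⟨x, hx, hxa, hxv⟩, y, hy, hya, hyv⟩ := hcon
    obtain ⟨u, hu, hux⟩ := (hAX x hx).2
    obtain ⟨v, hv, hvy⟩ := (hBY y hy).2
    rw [Finset.mem_inter] at hu hv
    refine hnP ((hP a).2 (Finset.not_disjoint_iff.2 ⟨(u, v), ?_, ?_⟩))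
    · refine Finset.mem_product.2 ⟨Finset.mem_filter.2 ⟨hu.1, ?_⟩, Finset.mem_filter.2 ⟨hv.1, ?_⟩⟩
      · simp [hux, leftAt, hxv, hxa.symm]
      · simp [hvy, rightAt, hyv, hya.symm]
    · exact Finset.mem_product.2 ⟨hu.2, hv.2⟩
  have h4 := (Finset.card_le_card h3).trans ((Finset.card_union_le _ _).trans
    (Nat.add_le_add_left (Finset.card_union_le _ _) _))
  rw [Finset.card_range] at h4
  have h5 : (G.numRect w : ℝ) ≤ ((Finset.range (G.numRect w)).filter P).card +
      ((((Finset.range (G.numRect w)).filter fun a =>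
        ∀ x ∈ A, x ≠ a → inner2 m a x = true).card : ℝ) +
      ((Finset.range (G.numRect w)).filter fun a =>
        ∀ x ∈ B, x ≠ a → inner2 m a x = false).card) := by exact_mod_cast h4
  have h6 : (0 : ℝ) ≤ G.numRect w := Nat.cast_nonneg _
  linarith

variable {G c b}

theorem card_colourClass (hc : IsBalanced c) : (m : ℝ) / 3 ≤ (colourClass c b).card := by
  obtain ⟨h1, h2⟩ := hc
  rw [Fintype.card_fin] at h1 h2
  cases b with
  | true => exact h1
  | false =>
    have h3 := Finset.card_filter_add_card_filter_not (s := Finset.univ) fun v => c v = true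
    simp only [Bool.not_eq_true, Finset.card_univ, Fintype.card_fin] at h3
    have h4 : ((Finset.univ.filter fun v => c v = true).card : ℝ) +
        (colourClass c false).card = m := by exact_mod_cast h3
    linarith

theorem IsSpectralExpander.card_few_nbr_le {d : ℕ} {γ : ℝ} (hG : G.IsSpectralExpander m d γ)
    (hm : 2 ≤ m) {X : Finset (Fin m)} (hX : 2 ^ 100 * (γ ^ 2 * m) ≤ (X.card : ℝ))
    (hγm : 1 ≤ γ ^ 2 * m) :
    ((Finset.univ.filter fun w => (G.nbr w ∩ X).card < 100).card : ℝ) ≤ m / 10 ^ 6 := by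
  set F := ((Finset.univ.filter fun w => (G.nbr w ∩ X).card < 100).card : ℝ) with hF
  have h1 := hG.card_few_nbr_mul_le hm (X.card / 100) 100 X (Nat.mul_div_le _ _)
  have h2 : (X.card : ℝ) ≤ 100 * ((X.card / 100 : ℕ) : ℝ) + 100 := by
    -- The rounding loss of 100 is absorbed by `2 ^ 100`, since `1 ≤ γ ^ 2 * m`.
    have : X.card ≤ 100 * (X.card / 100) + 100 := by omega
    exact_mod_cast this
  have h3 : 10 ^ 8 * (γ ^ 2 * m) ≤ ((X.card / 100 : ℕ) : ℝ) := by
    norm_num at hX ⊢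
    linarith
  have h4 : F * (10 ^ 8 * (γ ^ 2 * m)) ≤ 100 * (γ ^ 2 * m ^ 2) := by
    refine (mul_le_mul_of_nonneg_left h3 (Nat.cast_nonneg _)).trans ?_
    exact_mod_cast h1
  have h5 : (F * 10 ^ 6) * (100 * (γ ^ 2 * m)) ≤ m * (100 * (γ ^ 2 * m)) := by
    linarith
  have h6 := le_of_mul_le_mul_right h5 (by linarith)
  rw [le_div_iff₀ (by positivity)]
  exact h6

/-- Rounding the exponent down only raises the size threshold, which is therefore at least `2 ^ 100
γ ^ 2`. -/
theorem two_zpow_ge {γ : ℝ} (hγ : 0 < γ) :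
    2 ^ 100 * γ ^ 2 ≤ (2 : ℝ) ^ (-(⌊2 * Real.logb 2 (1 / γ)⌋ - 100)) := by
  have h1 : ((⌊2 * Real.logb 2 (1 / γ)⌋ : ℤ) : ℝ) ≤ 2 * Real.logb 2 (1 / γ) := Int.floor_le _
  have h2 : (2 : ℝ) ^ (100 + 2 * Real.logb 2 γ) = 2 ^ 100 * γ ^ 2 := by
    rw [Real.rpow_add two_pos, mul_comm (2 : ℝ) (Real.logb 2 γ), Real.rpow_mul two_pos.le,
      Real.rpow_logb two_pos (by norm_num) hγ]
    norm_num
  rw [← h2, ← Real.rpow_intCast]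
  refine Real.rpow_le_rpow_of_exponent_le one_le_two ?_
  rw [one_div, Real.logb_inv] at h1
  rw [one_div, Real.logb_inv]
  push_cast
  linarith

open scoped Classical in
theorem IsSpectralExpander.le_sum_hitting {d : ℕ} {γ : ℝ} (hG : G.IsSpectralExpander m d γ)
    (hm : 2 ≤ m) (hc : IsBalanced c) {X Y : Finset (Fin m)}
    (hX : 2 ^ 100 * (γ ^ 2 * m) ≤ (X.card : ℝ)) (hY : 2 ^ 100 * (γ ^ 2 * m) ≤ (Y.card : ℝ))
    (hγm : 1 ≤ γ ^ 2 * m) (P : Set (Finset (Fin m × Fin m)))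
    (hP : ∀ R, R ∈ P ↔ ¬ Disjoint R (X ×ˢ Y)) :
    (9 / 10 : ℝ) ≤ ∑ w ∈ colourClass c b, ((Finset.range (G.numRect w)).filter fun a =>
      G.leftSet w a ×ˢ G.rightSet w a ∈ P).card /
        ((G.numRect w : ℝ) * (1 + (colourClass c b).card)) := by
  set N : ℝ := ((colourClass c b).card : ℝ) with hN
  have hNpos : (0 : ℝ) < 1 + N := by positivity
  have hfX := hG.card_few_nbr_le hm hX hγm
  have hfY := hG.card_few_nbr_le hm hY hγm
  set FX := Finset.univ.filter fun w => (G.nbr w ∩ X).card < 100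
  set FY := Finset.univ.filter fun w => (G.nbr w ∩ Y).card < 100
  have h1 : ((colourClass c b).card : ℝ) ≤ ((colourClass c b) \ (FX ∪ FY)).card +
      (FX.card + FY.card) := by
    have h2 := Finset.le_card_sdiff (FX ∪ FY) (colourClass c b)
    have h3 := Finset.card_union_le FX FY
    have : (colourClass c b).card ≤ ((colourClass c b) \ (FX ∪ FY)).card +
      (FX.card + FY.card) := by omega
    exact_mod_cast this
  have hmN : (m : ℝ) / 3 ≤ N := card_colourClass hc
  -- A set `X` as large as assumed forces `2 ^ 100 ≤ m`; this much suffices to make the phantom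
  -- element negligible.
  have hmX : (1000 : ℝ) ≤ m := by
    have h4 : (X.card : ℝ) ≤ m := by
      have := Finset.card_le_univ X
      rw [Fintype.card_fin] at this
      exact_mod_cast this
    norm_num at hX
    linarith
  -- A vertex with many neighbours in both sets contributes at least 19/20 of its share. At most `2
  -- m / 10 ^ 6` vertices are lost, against at least `m / 3` of colour `b`, which leaves 9/10.
  have h5 : ∀ w ∈ (colourClass c b) \ (FX ∪ FY), (19 / 20 : ℝ) / (1 + N) ≤
      ((Finset.range (G.numRect w)).filter fun a =>
      G.leftSet w a ×ˢ G.rightSet w a ∈ P).card /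
        ((G.numRect w : ℝ) * (1 + N)) := by
    intro w hw
    have h6 := (Finset.mem_sdiff.1 hw).2
    simp only [FX, FY, Finset.mem_union, Finset.mem_filter, Finset.mem_univ, true_and, not_or,
      not_lt] at h6
    obtain ⟨h7, h8⟩ := G.le_card_hitting h6.1 h6.2
      (fun a => G.leftSet w a ×ˢ G.rightSet w a ∈ P) fun a => hP _
    have h9 : (0 : ℝ) < G.numRect w := by exact_mod_cast h7
    rw [div_le_div_iff₀ hNpos (by positivity), ← mul_assoc]
    exact mul_le_mul_of_nonneg_right h8 hNpos.le
  refine le_trans ?_ ((Finset.sum_le_sum h5).trans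
    (Finset.sum_le_sum_of_subset_of_nonneg Finset.sdiff_subset fun _ _ _ => by positivity))
  rw [Finset.sum_const, nsmul_eq_mul, mul_div_assoc', le_div_iff₀ hNpos]
  norm_num at hfX hfY
  linarith

end Multigraph

theorem theorem2 (b : Bool) :
    ∃ (M : Turing.TM2ComputableAux Bool (Option Bool)) (C : ℕ),
      ∀ (m d : ℕ) (γ : ℝ) (G : Multigraph (Fin m)) (c : Fin m → Bool),
        0 < γ →
        G.IsSpectralExpander m d γ →
        G.AtMostOneCommonNbr →
        IsBalanced c →
        1 / γ ^ 2 ≤ (m : ℝ) →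
        ∃ μ : PMF (Finset (Fin m × Fin m)),
          IsOverMonoRectangles (G.gadget c) b μ ∧
          IsHitting μ (1 / 10) (⌊2 * Real.logb 2 (1 / γ)⌋ - 100) ∧
          (∀ R, ∃ q : ℚ, (μ R).toReal = (q : ℝ)) ∧
          ∃ L : List (ListEntry m), IsListing μ L ∧
            OutputsWithin M (encodeInput G c) (encodeListing L) (m ^ C) := by
  classical
  refine ⟨Cmd.machine (Prog.listing b) .inp (Prog.seenVar none 0), 20, ?_⟩
  intro m d γ G c hγ hG hcommon hc hmγ
  have hγm : 1 ≤ γ ^ 2 * m := by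
    rw [div_le_iff₀ (by positivity)] at hmγ
    linarith
  -- The case `m = 0` contradicts `1 ≤ γ ^ 2 * m`, and a single vertex has no balanced colouring.
  have hm : 2 ≤ m := by
    by_contra hlt
    obtain rfl | rfl : m = 0 ∨ m = 1 := by omega
    · norm_num at hγm
    · obtain ⟨h1, h2⟩ := hc
      rw [Fintype.card_fin] at h1 h2
      generalize (Finset.univ.filter fun v => c v = true).card = k at h1 h2
      have h3 : 0 < k := by
        by_contra h
        obtain rfl : k = 0 := by omega
        norm_num at h1
      have h4 : (1 : ℝ) ≤ k := by exact_mod_cast h3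
      norm_num at h2
      linarith
  obtain ⟨μ, hμ, hL, hq, hsum⟩ := G.exists_distribution c b hcommon
  refine ⟨μ, hμ, ?_, hq, G.entries c b, hL, ?_⟩
  · intro X Y hX hY
    rw [Fintype.card_fin] at hX hY
    have h1 := mul_le_mul_of_nonneg_right (Multigraph.two_zpow_ge hγ) (Nat.cast_nonneg (α := ℝ) m)
    rw [mul_assoc] at h1
    have h2 := hG.le_sum_hitting (b := b) hm hc (h1.trans hX) (h1.trans hY) hγm
      {R | ¬ Disjoint R (X ×ˢ Y)} fun _ => Iff.rfl
    exact (show (1 : ℝ) - 1 / 10 ≤ 9 / 10 by norm_num).trans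
      (h2.trans (hsum _))
  · refine (Multigraph.outputsWithin_entries G c b).mono (listingTime_le hm ?_)
    have := Finset.card_le_univ (Multigraph.colourClass c b)
    rw [Fintype.card_fin] at this
    omega
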